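/- **Setting.** Let $p:[0,1]^2\to[0,1]$ be a Borel measurable payment function. For $\chi>0$, $\psi\ge 0$, $v,d,b\in[0,1]$ (value $v$, highest competing bid $d$, own bid $b$) put $$ r_{v,\chi,\psi,d}(b)=\mathbf 1[b\ge d]\,\bigl(\chi v-\psi\,p(b,d)\bigr). $$ Assume that (i) $p(0,0)=0$; (ii) for every $d$, $b\mapsto p(b,d)$ is non-decreasing and $1$-Lipschitz; (iii) there is a "safe bid" $b^\circ=b^\circ(v,\chi,\psi)\in[0,1]$, not depending on $d$, such that for all $v,\chi,\psi$: $r_{v,\chi,\psi,d}(b^\circ)\ge 0$ for all $d$, and whenever a bid $b$ satisfies $\inf_{d\in[0,1]}r_{v,\chi,\psi,d}(b)<0$, then $r_{v,\chi,\psi,d}(b^\circ)\ge r_{v,\chi,\psi,d}(b)$ for all $d$. In each round $t=1,\dots,T$ a (possibly randomized) adaptive adversary, knowing the complete record of the previous rounds including the bids, picks $v_t\in[0,1]$, $\chi_t>0$, $\psi_t\ge 0$ and $d_t\in[0,1]$. The algorithm sees $v_t,\chi_t,\psi_t$ and the complete record of the previous rounds (including $d_1,\dots,d_{t-1}$), but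 not $d_t$, and draws its bid $b_t\in[0,1]$ at random. Write $r_t=r_{v_t,\chi_t,\psi_t,d_t}$ and $U_\tau=\max_{t\le\tau}\max\{\chi_t,\psi_t\}$. **Theorem.** There is an absolute constant $C>0$ such that for every payment function $p$ as above, every $L\ge 1$ and every $T\ge 2$ there is a bidding algorithm with the following property. Against every adaptive adversary and for every $\delta>0$, with probability at least $1-\delta$ it holds simultaneously for all $1\le\tau_1\le\tau_2\le T$ that $$ \sup_{f}\ \sum_{t=\tau_1}^{\tau_2} r_t\bigl(f(v_t)\bigr)-\sum_{t=\tau_1}^{\tau_2} r_t(b_t)\ \le\ C\Bigl(U_{\tau_2}\sqrt{LT}\,\log T+U_{\tau_2}\sqrt{T\log(T/\delta)}\Bigr), $$ where the supremum is over all $L$-Lipschitz functions $f:[0,1]\to[0,1]$. (For $\delta\ge1$ the claim is vacuous.) -/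

import Mathlib

open MeasureTheory ProbabilityTheory
open scoped NNReal

/-- What the bidder knows about a round before bidding in it: the value `v ∈ [0,1]` and the
multipliers `χ > 0` and `ψ ≥ 0`. -/
abbrev Context : Type := unitInterval × Set.Ioi (0 : ℝ) × ℝ≥0

/-- The value `v` of a round. -/
def Context.v (c : Context) : unitInterval := c.1

/-- The multiplier `χ` of a round. -/
def Context.χ (c : Context) : ℝ := (c.2.1 : ℝ)

/-- The multiplier `ψ` of a round. -/
def Context.ψ (c : Context) : ℝ := (c.2.2 : ℝ)

/-- The reward of bidding `b` against the highest competing bid `d`: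
`1[b ≥ d] (χ v - ψ p(b, d))`. -/
noncomputable def reward (p : unitInterval → unitInterval → unitInterval) (c : Context)
    (d b : unitInterval) : ℝ :=
  if d ≤ b then c.χ * (c.v : ℝ) - c.ψ * (p b d : ℝ) else 0

/-- The standing assumption on the payment function `p(b, d)` (`b` the bid, `d` the highest
competing bid). -/
structure PaymentAssumption (p : unitInterval → unitInterval → unitInterval) : Prop where
  zero : p 0 0 = 0
  monotone : ∀ d, Monotone fun b => p b d
  lipschitz : ∀ d, LipschitzWith 1 fun b => p b d
  /-- A safe bid, which is a function of `v, χ, ψ` but not of `d`: its reward is never negative,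
  and it is at least as good, for every `d`, as any bid whose reward is negative for some `d`. -/
  safe : ∃ safeBid : Context → unitInterval, ∀ c : Context,
    (∀ d, 0 ≤ reward p c d (safeBid c)) ∧
    ∀ b, (∃ d, reward p c d b < 0) → ∀ d, reward p c d b ≤ reward p c d (safeBid c)

/-- The record of a finished round: the context `(v, χ, ψ)`, the highest competing bid `d`,
and the bid `b` that was placed. -/
abbrev Round : Type := Context × unitInterval × unitInterval

/-- The context `(v, χ, ψ)` of a finished round. -/
def Round.ctx (r : Round) : Context := r.1

/-- The highest competing bid of a finished round. -/
def Round.d (r : Round) : unitInterval := r.2.1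

/-- The bid placed in a finished round. -/
def Round.b (r : Round) : unitInterval := r.2.2

/-- The record of the first `t` rounds (rounds are numbered from `0`). -/
abbrev History (t : ℕ) : Type := Fin t → Round

/-- A (randomized) bidding algorithm under full-information feedback. In round `t` it draws its
bid from a distribution determined by the record of the previous rounds, which contains the
highest competing bids, and by the current `v, χ, ψ`; it does not see the current `d`. -/
structure BiddingAlgorithm where
  bid : (t : ℕ) → Kernel (History t × Context) unitInterval
  markov : ∀ t, IsMarkovKernel (bid t)

/-- A (randomized) adaptive adversary. Knowing the record of the previous rounds, including the
bids placed in them, it picks `v, χ, ψ` and the highest competing bid `d` of round `t`. -/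
structure AdaptiveAdversary where
  pick : (t : ℕ) → Kernel (History t) (Context × unitInterval)
  markov : ∀ t, IsMarkovKernel (pick t)

attribute [instance] BiddingAlgorithm.markov AdaptiveAdversary.markov

/-- The bid distribution of round `t`, as a kernel that ignores the current `d`. -/
noncomputable def BiddingAlgorithm.bidKernel (alg : BiddingAlgorithm) (t : ℕ) :
    Kernel (History t × Context × unitInterval) unitInterval :=
  (alg.bid t).comap (fun x => (x.1, x.2.1)) (by fun_prop)

instance (alg : BiddingAlgorithm) (t : ℕ) : IsMarkovKernel (alg.bidKernel t) := by
  unfold BiddingAlgorithm.bidKernel; infer_instance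

/-- Append the round with context and competing bid `x.1.2`, and bid `x.2`, to the
history `x.1.1`. -/
def appendRound (t : ℕ) (x : (History t × Context × unitInterval) × unitInterval) :
    History (t + 1) :=
  Fin.snoc (α := fun _ => Round) x.1.1 (x.1.2.1, x.1.2.2, x.2)

theorem measurable_appendRound (t : ℕ) : Measurable (appendRound t) := by
  refine measurable_pi_lambda _ fun i => ?_
  refine Fin.lastCases ?_ (fun j => ?_) i
  · simp only [appendRound, Fin.snoc_last]
    fun_prop
  · simp only [appendRound, Fin.snoc_castSucc]
    fun_prop

/-- The law of the record of the first `t` rounds when `alg` plays against `adv`: in every round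
the adversary first draws `(v, χ, ψ)` and `d`, and then the algorithm draws its bid. -/
noncomputable def playLaw (alg : BiddingAlgorithm) (adv : AdaptiveAdversary) :
    (t : ℕ) → Measure (History t)
  | 0 => Measure.dirac Fin.elim0
  | t + 1 =>
    (Measure.compProd (Measure.compProd (playLaw alg adv t) (adv.pick t)) (alg.bidKernel t)).map
      (appendRound t)

instance (alg : BiddingAlgorithm) (adv : AdaptiveAdversary) (t : ℕ) :
    IsProbabilityMeasure (playLaw alg adv t) := by
  induction t with
  | zero => unfold playLaw; infer_instance
  | succ t ih =>
    unfold playLaw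
    exact Measure.isProbabilityMeasure_map (measurable_appendRound t).aemeasurable

/-- The largest `χ` or `ψ` of the rounds up to and including round `τ`. -/
noncomputable def maxMultiplier {T : ℕ} (h : History T) (τ : Fin T) : ℝ :=
  (Finset.Iic τ).sup' Finset.nonempty_Iic fun t => max (h t).ctx.χ (h t).ctx.ψ

/-! Rewards are divided by the running maximum `u t` of the multipliers. `guardBid` replaces every
bid that could earn a negative reward by the safe bid, which never hurts. Guarded payoffs lie in
`[0,1]`, and raising a bid by `z` costs at most `z` whatever `d` is, although lowering it may cost
everything. Hence it suffices to compete with bids rounded up to a grid of mesh `ε = 2⁻ᴷ`, on value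
blocks of width `ε / L`, across which an `L`-Lipschitz `f` varies by at most one grid step.

The bidder uses chaining. From a common top bid it descends through `2K` heights with block lengths
`D = 1, 1, 2, 2, 4, 4, …`. At each height it lowers its bid by `D` with a probability that depends
on the height, on the current bid and on the group of `D` adjacent value blocks containing `v`. Such
descents with deterministic choices come within two grid steps of any `1`-Lipschitz integer sequence
(`exists_descends`).

Each probability is learned by projected gradient steps of size `1/D`. By `clipped_gradient_regret`
the regret of such a learner is paid for only by the rounds in which lowering beats keeping. By
one-sided Lipschitzness, the advantage of lowering is at most the loss of the subtree against its
own starting bid, plus `4Dε`. So the regret bounds `B` of consecutive heights satisfy `B' = (1 +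
2/D) B + R` with `R` of order `L 2ᴷ + εT` (`treeValue_regret`). As `∑ 1/D ≤ 4`, the factors multiply
to a constant; `2ᴷ ≈ √(T/L)` gives `R ≈ √(LT)`, and there are `O(log T)` heights.

With fixed step sizes the bound holds on every interval of rounds. Summation by parts
(`sum_monotone_mul_le`) turns normalized regret on all suffixes of an interval into true regret.
Azuma–Hoeffding with a union bound over the intervals passes from expected to realized rewards. -/

/-! ### Projected gradient steps with a one-sided regret bound. -/

/-- Projected gradient step on `[0,1]`: every interval of rounds has regret at most
`1/(2η) + 1 + 2η ∑ y⁻`. -/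
theorem clipped_gradient_regret {η : ℝ} (hη : 0 < η) (w y : ℕ → ℝ) (s e : ℕ) (hse : s ≤ e)
    (hw : ∀ t, w t ∈ Set.Icc (0 : ℝ) 1)
    (hstep : ∀ t ∈ Finset.Ico s e, w (t + 1) = max 0 (min 1 (w t - η * y t)))
    (hy : ∀ t ∈ Finset.Ico s e, |y t| ≤ 1) {u : ℝ} (hu : u ∈ Set.Icc (0 : ℝ) 1) :
    ∑ t ∈ Finset.Ico s e, y t * (w t - u)
      ≤ 1 / (2 * η) + 1 + 2 * η * ∑ t ∈ Finset.Ico s e, max 0 (-y t) := by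
  have key : ∀ t ∈ Finset.Ico s e, y t * (w t - u) ≤
      (w t - u) ^ 2 / (2 * η) - (w (t + 1) - u) ^ 2 / (2 * η) + (w t - w (t + 1))
        + 2 * η * max 0 (-y t) := by
    intro t ht
    have h1 := hstep t ht
    have h2 := abs_le.1 (hy t ht)
    have hwt := hw t
    have hwt' := hw (t + 1)
    set a := w t
    set b := w (t + 1)
    set z := y t
    have hproj : η * z * (b - u) ≤ (a - b) * (b - u) := by
      have : 0 ≤ (a - η * z - b) * (b - u) := by
        rcases le_total (a - η * z) 0 with h | h
        · have : b = 0 := by rw [h1, min_eq_right (by linarith), max_eq_left h]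
          rw [this]
          nlinarith [hu.1]
        · rcases le_total (a - η * z) 1 with h' | h'
          · have : b = a - η * z := by rw [h1, min_eq_right h', max_eq_right h]
            rw [this]; simp
          · have : b = 1 := by rw [h1, min_eq_left h']; simp
            rw [this]
            nlinarith [hu.2]
      linarith
    have hrise : b - a ≤ η * max 0 (-z) := by
      have h3 : a - η * z ≤ a + η * max 0 (-z) := by
        nlinarith [le_max_right 0 (-z)]
      have h4 : 0 ≤ η * max 0 (-z) := mul_nonneg hη.le (le_max_left _ _)
      rw [h1]
      have : max 0 (min 1 (a - η * z)) ≤ a + η * max 0 (-z) :=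
        max_le (by linarith [hwt.1]) (le_trans (min_le_right _ _) h3)
      linarith
    -- A rise of `w` costs at most its length, which is the (negative) net decrease plus twice the
    -- rise, and a rise is at most `η y⁻`. The net decreases telescope, so only `y⁻` is charged.
    have hmove : z * (a - b) ≤ (a - b) + 2 * η * max 0 (-z) := by
      have h4 : 0 ≤ η * max 0 (-z) := mul_nonneg hη.le (le_max_left _ _)
      rcases le_total b a with h | h
      · nlinarith
      · nlinarith
    have h5 : z * (a - u) = z * (a - b) + (η * z * (b - u)) / η := by
      field_simp; ring
    have h6 : (η * z * (b - u)) / η ≤ ((a - b) * (b - u)) / η := by gcongr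
    have h7 : ((a - b) * (b - u)) / η
        ≤ (a - u) ^ 2 / (2 * η) - (b - u) ^ 2 / (2 * η) := by
      rw [← sub_div, div_le_div_iff₀ hη (by positivity)]
      nlinarith [mul_nonneg hη.le (sq_nonneg (a - b))]
    linarith
  refine (Finset.sum_le_sum key).trans ?_
  rw [Finset.sum_add_distrib, Finset.sum_add_distrib, ← Finset.mul_sum]
  have t1 : ∑ t ∈ Finset.Ico s e, ((w t - u) ^ 2 / (2 * η) - (w (t + 1) - u) ^ 2 / (2 * η))
      ≤ 1 / (2 * η) := by
    have := Finset.sum_Ico_sub (fun t => -((w t - u) ^ 2 / (2 * η))) hse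
    have h : (w s - u) ^ 2 / (2 * η) ≤ 1 / (2 * η) := by
      gcongr
      have := hw s
      have a1 : w s - u ≤ 1 := by linarith [this.2, hu.1]
      have a2 : -1 ≤ w s - u := by linarith [this.1, hu.2]
      nlinarith
    have h' : 0 ≤ (w e - u) ^ 2 / (2 * η) := by positivity
    calc _ = ∑ t ∈ Finset.Ico s e,
          (-((w (t + 1) - u) ^ 2 / (2 * η)) - -((w t - u) ^ 2 / (2 * η))) :=
          Finset.sum_congr rfl fun t _ => by ring
      _ ≤ _ := by rw [this]; linarith
  have t2 : ∑ t ∈ Finset.Ico s e, (w t - w (t + 1)) ≤ 1 := by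
    have := Finset.sum_Ico_sub (fun t => -w t) hse
    calc _ = ∑ t ∈ Finset.Ico s e, (-w (t + 1) - -w t) :=
          Finset.sum_congr rfl fun t _ => by ring
      _ ≤ _ := by rw [this]; linarith [(hw s).2, (hw e).1]
  linarith

/-! ### Block lengths of the bidding tree. -/

/-- The side length of the blocks at height `n` of the bidding tree, which is also the amount by
which a bid may be lowered at that height. -/
def blockLength (n : ℕ) : ℕ := 2 ^ (n / 2)

theorem blockLength_pos (n : ℕ) : 0 < blockLength n := by unfold blockLength; positivity

theorem blockLength_dvd_succ (n : ℕ) : blockLength n ∣ blockLength (n + 1) :=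
  pow_dvd_pow 2 (Nat.div_le_div_right n.le_succ)

theorem blockLength_two_mul (k : ℕ) : blockLength (2 * k) = 2 ^ k := by
  simp [blockLength]

theorem blockLength_two_mul_add_one (k : ℕ) : blockLength (2 * k + 1) = 2 ^ k := by
  unfold blockLength; congr 1; omega

theorem div_blockLength_eq_of_succ {n q q' : ℕ} (h : q / blockLength n = q' / blockLength n) :
    q / blockLength (n + 1) = q' / blockLength (n + 1) := by
  obtain ⟨r, hr⟩ := blockLength_dvd_succ n
  rw [hr, ← Nat.div_div_eq_div_mul, ← Nat.div_div_eq_div_mul, h]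

theorem sum_blockLength_two_mul (k : ℕ) :
    ∑ j ∈ Finset.range (2 * k), blockLength j + 2 = 2 * 2 ^ k := by
  induction k with
  | zero => simp
  | succ k ih =>
    rw [show 2 * (k + 1) = 2 * k + 1 + 1 by ring, Finset.sum_range_succ, Finset.sum_range_succ,
      blockLength_two_mul, blockLength_two_mul_add_one, pow_succ]
    omega

/-- This needs each power of two to occur twice. It lets the remaining heights absorb an error of
`2D` when a block is not lowered in `exists_descends`. -/
theorem two_mul_blockLength_le (n : ℕ) :
    2 * blockLength n ≤ ∑ j ∈ Finset.range n, blockLength j + 2 := by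
  obtain ⟨k, rfl | rfl⟩ := Nat.even_or_odd' n
  · rw [sum_blockLength_two_mul, blockLength_two_mul]
  · have := sum_blockLength_two_mul k
    rw [Finset.sum_range_succ, blockLength_two_mul, blockLength_two_mul_add_one]
    omega

theorem sum_blockLength_succ_le (n : ℕ) :
    ∑ j ∈ Finset.range (n + 1), blockLength j ≤ 4 * blockLength n := by
  obtain ⟨k, rfl | rfl⟩ := Nat.even_or_odd' n
  · have := sum_blockLength_two_mul k
    rw [Finset.sum_range_succ, blockLength_two_mul]
    omega
  · have := sum_blockLength_two_mul (k + 1)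
    rw [show 2 * (k + 1) = 2 * k + 1 + 1 by ring, pow_succ] at this
    rw [blockLength_two_mul_add_one]
    omega

/-- Keeps the product of the factors `1 + 2/D` over all heights below `exp 8`. -/
theorem sum_inv_blockLength_le (k : ℕ) :
    ∑ j ∈ Finset.range (2 * k), (1 : ℝ) / blockLength j ≤ 4 := by
  have : ∑ j ∈ Finset.range (2 * k), (1 : ℝ) / blockLength j = 4 - 4 / 2 ^ k := by
    induction k with
    | zero => simp
    | succ k ih =>
      rw [show 2 * (k + 1) = 2 * k + 1 + 1 by ring, Finset.sum_range_succ,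
        Finset.sum_range_succ, ih, blockLength_two_mul, blockLength_two_mul_add_one, pow_succ]
      push_cast
      field_simp
      ring
  rw [this]
  have : (0 : ℝ) ≤ 4 / 2 ^ k := by positivity
  linarith

/-! ### The randomized descent and its regret. -/

/-- The value of the randomized strategy of height `n` started at bid `m`, for the payoff `x` and
block coordinate `q`: at each height it either keeps its bid or lowers it by the block length, the
latter with probability given by the weight `w`. -/
def treeValue (x : ℕ → ℝ) (q : ℕ) (w : ℕ → ℕ → ℕ → ℝ) : ℕ → ℕ → ℝ
  | 0, m => x m
  | n + 1, m =>
    (1 - w n (q / blockLength n) m) * treeValue x q w n m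
      + w n (q / blockLength n) m * treeValue x q w n (m - blockLength n)

/-- The payoff advantage at height `n` of keeping the bid over lowering it. -/
def treeGap (x : ℕ → ℝ) (q : ℕ) (w : ℕ → ℕ → ℕ → ℝ) (n m : ℕ) : ℝ :=
  treeValue x q w n m - treeValue x q w n (m - blockLength n)

/-- The value is affine in the top weight with slope `-treeGap`, so `treeUpdate` is projected
gradient ascent. -/
theorem treeValue_succ (x : ℕ → ℝ) (q : ℕ) (w : ℕ → ℕ → ℕ → ℝ) (n m : ℕ) :
    treeValue x q w (n + 1) m =
      treeValue x q w n m - w n (q / blockLength n) m * treeGap x q w n m := by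
  rw [treeValue, treeGap]; ring

/-- Gradient update of all weights after a round. -/
noncomputable def treeUpdate (x : ℕ → ℝ) (q : ℕ) (w : ℕ → ℕ → ℕ → ℝ) (n j m : ℕ) : ℝ :=
  -- The weights of all bids `m` are updated, visited or not: with `d` revealed, every
  -- counterfactual gap is known.
  if q / blockLength n = j then
    max 0 (min 1 (w n j m - 1 / blockLength n * treeGap x q w n m))
  else w n j m

theorem treeUpdate_mem_Icc {x : ℕ → ℝ} {q : ℕ} {w : ℕ → ℕ → ℕ → ℝ}
    (hw : ∀ n j m, w n j m ∈ Set.Icc (0 : ℝ) 1) (n j m : ℕ) :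
    treeUpdate x q w n j m ∈ Set.Icc (0 : ℝ) 1 := by
  unfold treeUpdate
  split_ifs
  · exact ⟨le_max_left _ _, max_le zero_le_one (min_le_left _ _)⟩
  · exact hw n j m

theorem treeValue_mem_Icc {x : ℕ → ℝ} {q : ℕ} {w : ℕ → ℕ → ℕ → ℝ}
    (hx : ∀ m, x m ∈ Set.Icc (0 : ℝ) 1) (hw : ∀ n j m, w n j m ∈ Set.Icc (0 : ℝ) 1) (n m : ℕ) :
    treeValue x q w n m ∈ Set.Icc (0 : ℝ) 1 := by
  induction n generalizing m with
  | zero => exact hx m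
  | succ n ih =>
    have h := hw n (q / blockLength n) m
    exact (convex_Icc (0 : ℝ) 1) (ih m) (ih _) (by linarith [h.2]) h.1 (by ring)

/-- All bids reachable from `m` lie at most `∑ blockLength` below it. -/
theorem treeValue_le {x : ℕ → ℝ} {q : ℕ} {w : ℕ → ℕ → ℕ → ℝ} {ε : ℝ} (hε : 0 ≤ ε)
    (hx : ∀ m k, x (m - k) ≤ x m + k * ε) (hw : ∀ n j m, w n j m ∈ Set.Icc (0 : ℝ) 1)
    (n m k : ℕ) :
    treeValue x q w n (m - k)
      ≤ x m + ((k + ∑ j ∈ Finset.range n, blockLength j : ℕ) : ℝ) * ε := by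
  induction n generalizing k with
  | zero => simpa [treeValue] using hx m k
  | succ n ih =>
    have h := hw n (q / blockLength n) (m - k)
    have h1 := ih k
    have h2 := ih (k + blockLength n)
    rw [← Nat.sub_sub] at h2
    rw [treeValue, Finset.sum_range_succ]
    have h3 : ((k + ∑ j ∈ Finset.range n, blockLength j : ℕ) : ℝ) * ε ≤
      ((k + (∑ j ∈ Finset.range n, blockLength j + blockLength n) : ℕ) : ℝ) * ε := by
      gcongr; omega
    rw [show k + blockLength n + ∑ j ∈ Finset.range n, blockLength j
      = k + (∑ j ∈ Finset.range n, blockLength j + blockLength n) by ring] at h2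
    nlinarith [h.1, h.2]

/-- `c` arises from `a` by lowering bids blockwise at the heights below `n`. -/
def Descends : ℕ → (ℕ → ℕ) → (ℕ → ℕ) → Prop
  | 0, a, c => a = c
  | n + 1, a, c => ∃ σ : ℕ → Prop, ∃ _ : DecidablePred σ,
      Descends n (fun q => a q - if σ (q / blockLength n) then blockLength n else 0) c

theorem Descends.refl (n : ℕ) (a : ℕ → ℕ) : Descends n a a := by
  induction n with
  | zero => rfl
  | succ n ih => exact ⟨fun _ => False, inferInstance, by simpa using ih⟩

/-- Regret of one height of the tree, summed over its blocks. -/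
theorem treeGap_regret {x : ℕ → ℕ → ℝ} {q : ℕ → ℕ} {w : ℕ → ℕ → ℕ → ℕ → ℝ} {Q s e : ℕ}
    (hse : s ≤ e) (hx : ∀ t m, x t m ∈ Set.Icc (0 : ℝ) 1)
    (hw : ∀ t n j m, w t n j m ∈ Set.Icc (0 : ℝ) 1)
    (hstep : ∀ t ∈ Finset.Ico s e, w (t + 1) = treeUpdate (x t) (q t) (w t))
    (hq : ∀ t ∈ Finset.Ico s e, q t ≤ Q) (n : ℕ) (a : ℕ → ℕ)
    (ha : ∀ i j, i / blockLength n = j / blockLength n → a i = a j) (u : ℕ → ℝ)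
    (hu : ∀ j, u j ∈ Set.Icc (0 : ℝ) 1) :
    ∑ t ∈ Finset.Ico s e, treeGap (x t) (q t) (w t) n (a (q t)) *
        (w t n (q t / blockLength n) (a (q t)) - u (q t / blockLength n))
      ≤ ((Q / blockLength n + 1 : ℕ) : ℝ) * (blockLength n / 2 + 1)
        + 2 / blockLength n *
          ∑ t ∈ Finset.Ico s e, max 0 (-treeGap (x t) (q t) (w t) n (a (q t))) := by
  set D := blockLength n with hD
  have hDpos : (0 : ℝ) < D := by exact_mod_cast blockLength_pos n
  -- One learner per block `j`, idle outside it. As `a` is constant on blocks, `j * D` represents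
  -- block `j`, and the learner always faces the same bid.
  set y : ℕ → ℕ → ℝ := fun j t =>
    if q t / D = j then treeGap (x t) (q t) (w t) n (a (j * D)) else 0 with hydef
  have hrep : ∀ t, a (q t / D * D) = a (q t) := fun t =>
    ha _ _ (by rw [Nat.mul_div_cancel _ (blockLength_pos n)])
  have hj : ∀ j, ∑ t ∈ Finset.Ico s e, y j t * (w t n j (a (j * D)) - u j)
      ≤ (D / 2 + 1) + 2 / D * ∑ t ∈ Finset.Ico s e, max 0 (-y j t) := by
    intro j
    have := clipped_gradient_regret (η := 1 / (D : ℝ)) (by positivity)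
      (fun t => w t n j (a (j * D))) (y j) s e hse (fun t => hw t _ _ _)
      (by
        intro t ht
        simp only [hstep t ht, treeUpdate, hydef, ← hD]
        split_ifs with h
        · rfl
        · have := hw t n j (a (j * D))
          simp [this.1, this.2])
      (by
        intro t ht
        simp only [hydef]
        split_ifs
        · have h1 := treeValue_mem_Icc (q := q t) (hx t) (hw t) n (a (j * D))
          have h2 := treeValue_mem_Icc (q := q t) (hx t) (hw t) n (a (j * D) - blockLength n)
          rw [treeGap, abs_le]
          constructor <;> linarith [h1.1, h1.2, h2.1, h2.2]
        · simp) (hu j)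
    calc _ ≤ _ := this
      _ = _ := by field_simp
  have hsum := Finset.sum_le_sum (s := Finset.range (Q / D + 1)) fun j _ => hj j
  have hmem : ∀ t ∈ Finset.Ico s e, q t / D ∈ Finset.range (Q / D + 1) := fun t ht =>
    Finset.mem_range.2 (Nat.lt_succ_of_le (Nat.div_le_div_right (hq t ht)))
  have hcollapse : ∀ f : ℕ → ℕ → ℝ, (∀ t j, q t / D ≠ j → f j t = 0) →
      ∑ j ∈ Finset.range (Q / D + 1), ∑ t ∈ Finset.Ico s e, f j t =
        ∑ t ∈ Finset.Ico s e, f (q t / D) t := by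
    intro f hf
    rw [Finset.sum_comm]
    exact Finset.sum_congr rfl fun t ht =>
      Finset.sum_eq_single_of_mem _ (hmem t ht) fun j _ hne => hf t j hne.symm
  rw [Finset.sum_add_distrib, ← Finset.mul_sum, Finset.sum_const, Finset.card_range,
    nsmul_eq_mul, hcollapse _ (fun t j h => by simp [hydef, h]),
    hcollapse _ (fun t j h => by simp [hydef, h])] at hsum
  simpa only [hydef, if_true, hrep] using hsum

/-- Regret of the whole tree on an interval of rounds against every blockwise descending family
of bids. -/
theorem treeValue_regret {x : ℕ → ℕ → ℝ} {q : ℕ → ℕ} {w : ℕ → ℕ → ℕ → ℕ → ℝ} {Q s e : ℕ}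
    {ε R : ℝ} (hε : 0 ≤ ε) (hR : 0 ≤ R) (hse : s ≤ e) (hx : ∀ t m, x t m ∈ Set.Icc (0 : ℝ) 1)
    (hxm : ∀ t m k, x t (m - k) ≤ x t m + k * ε)
    (hw : ∀ t n j m, w t n j m ∈ Set.Icc (0 : ℝ) 1)
    (hstep : ∀ t ∈ Finset.Ico s e, w (t + 1) = treeUpdate (x t) (q t) (w t))
    (hq : ∀ t ∈ Finset.Ico s e, q t ≤ Q) (N n : ℕ) (hn : n ≤ N)
    (hN : ∀ n < N, ((Q / blockLength n + 1 : ℕ) : ℝ) * (blockLength n / 2 + 1)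
      + 8 * ε * ((e - s : ℕ) : ℝ) ≤ R)
    (a c : ℕ → ℕ) (ha : ∀ i j, i / blockLength n = j / blockLength n → a i = a j)
    (hac : Descends n a c) :
    ∑ t ∈ Finset.Ico s e, (x t (c (q t)) - treeValue (x t) (q t) (w t) n (a (q t)))
      ≤ Real.exp (2 * ∑ j ∈ Finset.range n, (1 : ℝ) / blockLength j) * (n * R) := by
  induction n generalizing a c with
  | zero =>
    obtain rfl : a = c := hac
    simp [treeValue]
  | succ n ih =>
    obtain ⟨σ, hσ, hac⟩ := hac
    set S := ∑ j ∈ Finset.range n, (1 : ℝ) / blockLength j with hS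
    set D := blockLength n with hD
    have hDpos : (0 : ℝ) < D := by exact_mod_cast blockLength_pos n
    have ha' : ∀ i j, i / D = j / D → a i = a j := fun i j h =>
      ha i j (div_blockLength_eq_of_succ h)
    -- The induction hypothesis is used twice: against the comparator after its own move at this
    -- height, and (`h2`) against staying at `a`, which pays for the negative gaps.
    have h1 := ih (by omega) _ c (fun i j h => by rw [h, ha' i j h]) hac
    have h2 := ih (by omega) a a ha' (Descends.refl n a)
    have h3 := treeGap_regret hse hx hw hstep hq n a ha' (fun j => if σ j then 1 else 0)
      (fun j => by split_ifs <;> simp)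
    set B := Real.exp (2 * S) * (n * R)
    have h4 : ∑ t ∈ Finset.Ico s e, max 0 (-treeGap (x t) (q t) (w t) n (a (q t)))
        ≤ B + 4 * D * ε * ((e - s : ℕ) : ℝ) := by
      -- Starting from `a - D` only bids at most `4D` below `a` are reached, so that value is at
      -- most `x a + 4Dε`.
      have : ∀ t ∈ Finset.Ico s e, max 0 (-treeGap (x t) (q t) (w t) n (a (q t)))
          ≤ (x t (a (q t)) - treeValue (x t) (q t) (w t) n (a (q t))) + 4 * D * ε := by
        intro t _
        have e1 := treeValue_le (q := q t) hε (hxm t) (hw t) n (a (q t)) 0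
        have e2 := treeValue_le (q := q t) hε (hxm t) (hw t) n (a (q t)) D
        have e3 := sum_blockLength_succ_le n
        rw [Finset.sum_range_succ] at e3
        have e4 : ((0 + ∑ j ∈ Finset.range n, blockLength j : ℕ) : ℝ) * ε ≤ 4 * D * ε := by
          gcongr
          exact_mod_cast (by omega : 0 + ∑ j ∈ Finset.range n, blockLength j ≤ 4 * D)
        have e5 : ((D + ∑ j ∈ Finset.range n, blockLength j : ℕ) : ℝ) * ε ≤ 4 * D * ε := by
          gcongr
          exact_mod_cast (by omega : D + ∑ j ∈ Finset.range n, blockLength j ≤ 4 * D)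
        rw [Nat.sub_zero] at e1
        refine max_le (by linarith) ?_
        rw [treeGap]
        linarith
      refine (Finset.sum_le_sum this).trans ?_
      rw [Finset.sum_add_distrib, Finset.sum_const, Nat.card_Ico, nsmul_eq_mul]
      linarith
    -- Replacing the learned weight by the comparator's choice `σ` changes the value by the gap
    -- times their difference.
    have h5 : ∑ t ∈ Finset.Ico s e,
        (x t (c (q t)) - treeValue (x t) (q t) (w t) (n + 1) (a (q t))) =
        ∑ t ∈ Finset.Ico s e, (x t (c (q t)) - treeValue (x t) (q t) (w t) n
          (a (q t) - if σ (q t / D) then D else 0)) +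
        ∑ t ∈ Finset.Ico s e, treeGap (x t) (q t) (w t) n (a (q t)) *
          (w t n (q t / D) (a (q t)) - if σ (q t / D) then 1 else 0) := by
      rw [← Finset.sum_add_distrib]
      refine Finset.sum_congr rfl fun t _ => ?_
      rw [treeValue_succ]
      split_ifs
      · rw [treeGap]; ring
      · rw [Nat.sub_zero]; ring
    rw [h5]
    have h6 : 2 / (D : ℝ) * ∑ t ∈ Finset.Ico s e, max 0 (-treeGap (x t) (q t) (w t) n (a (q t)))
        ≤ 2 / D * B + 8 * ε * ((e - s : ℕ) : ℝ) := by
      calc _ ≤ 2 / (D : ℝ) * (B + 4 * D * ε * ((e - s : ℕ) : ℝ)) := by gcongr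
        _ = _ := by field_simp; ring
    have h7 := hN n (by omega)
    have h8 : (1 + 2 / D) * B + R
        ≤ Real.exp (2 * ∑ j ∈ Finset.range (n + 1), (1 : ℝ) / blockLength j)
          * ((n + 1 : ℕ) * R) := by
      rw [Finset.sum_range_succ, mul_add, Real.exp_add, ← hS, ← hD]
      have e1 : 1 + 2 / (D : ℝ) ≤ Real.exp (2 * (1 / D)) := by
        have := Real.add_one_le_exp (2 * (1 / (D : ℝ)))
        calc _ = 2 * (1 / (D : ℝ)) + 1 := by ring
          _ ≤ _ := this
      have e2 : 1 ≤ Real.exp (2 * S) * Real.exp (2 * (1 / D)) := by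
        rw [← Real.exp_add]
        exact Real.one_le_exp (by positivity)
      have e3 : 0 ≤ B := by positivity
      calc _ ≤ Real.exp (2 * (1 / D)) * B + (Real.exp (2 * S) * Real.exp (2 * (1 / D))) * R := by
            gcongr
            nlinarith
        _ = _ := by push_cast; ring
    linarith

/-- Every `1`-Lipschitz sequence is approximated by a blockwise descent from a constant. -/
theorem exists_descends {F : ℕ → ℕ}
    (hF : ∀ n i j, i / blockLength n = j / blockLength n → F i ≤ F j + blockLength n)
    (n : ℕ) (a : ℕ → ℕ) (ha : ∀ i j, i / blockLength n = j / blockLength n → a i = a j)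
    (h1 : ∀ i, F i ≤ a i)
    (h2 : ∀ i, a i ≤ F i + (∑ j ∈ Finset.range n, blockLength j + 2)) :
    ∃ c, Descends n a c ∧ ∀ i, F i ≤ c i ∧ c i ≤ F i + 2 := by
  classical
  induction n generalizing a with
  | zero => exact ⟨a, rfl, fun i => ⟨h1 i, by simpa using h2 i⟩⟩
  | succ n ih =>
    set D := blockLength n with hD
    have ha' : ∀ i j, i / D = j / D → a i = a j := fun i j h =>
      ha i j (div_blockLength_eq_of_succ h)
    -- A block is lowered only if `a` stays above `F` on all of it; then the subtraction is not
    -- truncated.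
    let σ : ℕ → Prop := fun k => ∀ i, i / D = k → F i + D ≤ a i
    obtain ⟨c, hc, hc'⟩ := ih (fun q => a q - if σ (q / D) then D else 0)
      (fun i j h => by rw [h, ha' i j h])
      (by
        intro i
        split_ifs with h
        · have := h i rfl
          omega
        · simpa using h1 i)
      (by
        intro i
        have e2 := h2 i
        rw [Finset.sum_range_succ] at e2
        split_ifs with h
        · omega
        · simp only [σ, not_forall, not_le] at h
          obtain ⟨i', hi', hlt⟩ := h
          -- Where nothing is lowered, some `i'` in the block has `a < F i' + D ≤ F i + 2D`.
          have e3 := hF n i' i hi'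
          have e4 := two_mul_blockLength_le n
          rw [ha' i i' hi'.symm]
          omega)
    exact ⟨c, ⟨σ, inferInstance, hc⟩, hc'⟩

/-! ### Summation by parts. -/

/-- Summation by parts: a bound on all suffix sums carries over to monotone weights. -/
theorem sum_monotone_mul_le {U ρ : ℕ → ℝ} (hU : Monotone U) {M : ℝ} {s e : ℕ} (hse : s ≤ e)
    (hM : ∀ k, s ≤ k → k ≤ e → ∑ t ∈ Finset.Ico k (e + 1), ρ t ≤ M) (hU0 : 0 ≤ U s) :
    ∑ t ∈ Finset.Ico s (e + 1), U t * ρ t ≤ U e * M := by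
  -- Downward induction on the left end `k`, with `d = e - k`.
  have key : ∀ d k, k + d = e → s ≤ k →
      ∑ t ∈ Finset.Ico k (e + 1), U t * ρ t - U k * ∑ t ∈ Finset.Ico k (e + 1), ρ t
        ≤ M * (U e - U k) := by
    intro d
    induction d with
    | zero =>
      rintro k rfl -
      simp
    | succ d ih =>
      intro k hk hsk
      have h1 := ih (k + 1) (by omega) (by omega)
      have h2 := hM (k + 1) (by omega) (by omega)
      have h3 : U k ≤ U (k + 1) := hU k.le_succ
      rw [Finset.sum_eq_sum_Ico_succ_bot (by omega) fun t => U t * ρ t,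
        Finset.sum_eq_sum_Ico_succ_bot (by omega) ρ]
      nlinarith
  have h1 := key (e - s) s (by omega) le_rfl
  have h2 := hM s le_rfl hse
  nlinarith

/-! ### Safe bids: measurable selection and guarded bids. -/

/-- The reward with `χ v = q` and `ψ = 1`. -/
noncomputable def unitReward (p : unitInterval → unitInterval → unitInterval) (q : ℝ)
    (d b : unitInterval) : ℝ :=
  if d ≤ b then q - (p b d : ℝ) else 0

/-- `s` is a safe bid for `unitReward p q`. -/
def IsSafeBid (p : unitInterval → unitInterval → unitInterval) (q : ℝ) (s : unitInterval) : Prop :=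
  (∀ d, 0 ≤ unitReward p q d s) ∧
    ∀ b, (∃ d, unitReward p q d b < 0) → ∀ d, unitReward p q d b ≤ unitReward p q d s

/-- The largest possible payment when bidding `b`. -/
noncomputable def maxPayment (p : unitInterval → unitInterval → unitInterval)
    (b : unitInterval) : unitInterval :=
  ⨆ d : Set.Iic b, p b d

/-- The supremum of the bids whose payment never exceeds `q`. -/
noncomputable def supSafe (p : unitInterval → unitInterval → unitInterval) (q : ℝ) :
    unitInterval :=
  sSup {s | (maxPayment p s : ℝ) ≤ q}

section SafeBid

variable {p : unitInterval → unitInterval → unitInterval}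

theorem reward_eq_mul_unitReward {c : Context} (hψ : 0 < c.ψ) (d b : unitInterval) :
    reward p c d b = c.ψ * unitReward p (c.χ * c.v / c.ψ) d b := by
  unfold reward unitReward
  split_ifs
  · field_simp
  · simp

theorem Context.χ_pos (c : Context) : 0 < c.χ := c.2.1.2

theorem Context.ψ_nonneg (c : Context) : 0 ≤ c.ψ := c.2.2.2

theorem Context.χ_mul_v_nonneg (c : Context) : 0 ≤ c.χ * (c.v : ℝ) :=
  mul_nonneg c.χ_pos.le c.v.2.1

theorem lt_maxPayment_iff {q : ℝ} {b : unitInterval} :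
    q < maxPayment p b ↔ (∃ d ≤ b, q < p b d) := by
  constructor
  · intro h
    by_contra! hcon
    rcases lt_or_ge q 0 with hq | hq
    · exact absurd (hcon b le_rfl) (not_le.2 (hq.trans_le (p b b).2.1))
    · rcases le_total q 1 with hq1 | hq1
      · have : maxPayment p b ≤ ⟨q, hq, hq1⟩ := iSup_le fun d => hcon d d.2
        exact absurd (Subtype.coe_le_coe.2 this) (not_le.2 h)
      · exact absurd ((maxPayment p b).2.2.trans hq1) (not_le.2 h)
  · rintro ⟨d, hd, h⟩
    refine h.trans_le ?_
    exact Subtype.coe_le_coe.2 (le_iSup (fun d : Set.Iic b => p b d) ⟨d, hd⟩)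

theorem PaymentAssumption.monotone_maxPayment (hp : PaymentAssumption p) :
    Monotone (maxPayment p) := by
  intro b b' h
  refine iSup_le fun d => ?_
  exact (hp.monotone d h).trans
    (le_iSup (fun d : Set.Iic b' => p b' d) ⟨d, d.2.trans h⟩)

theorem exists_unitReward_neg_iff {q : ℝ} {b : unitInterval} :
    (∃ d, unitReward p q d b < 0) ↔ q < maxPayment p b := by
  rw [lt_maxPayment_iff]
  refine exists_congr fun d => ?_
  unfold unitReward
  split_ifs with h <;> simp [h]

theorem exists_reward_neg_iff {c : Context} {b : unitInterval} :
    (∃ d, reward p c d b < 0) ↔ c.χ * c.v < c.ψ * maxPayment p b := by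
  rcases c.ψ_nonneg.eq_or_lt with h | h
  · have := c.χ_mul_v_nonneg
    simp only [reward, ← h, zero_mul, sub_zero, not_lt.2 this, iff_false, not_exists, not_lt]
    intro d
    split_ifs <;> simp [this]
  · simp only [reward_eq_mul_unitReward h, mul_neg_iff, h, true_and, not_lt.2 h.le, false_and,
      or_false, exists_unitReward_neg_iff, div_lt_iff₀' h]

theorem monotone_supSafe : Monotone (supSafe p) := fun _ _ h =>
  sSup_le_sSup fun _ hs => le_trans hs h

theorem le_supSafe {q : ℝ} {s : unitInterval} (h : IsSafeBid p q s) : s ≤ supSafe p q :=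
  le_sSup (by
    by_contra hcon
    obtain ⟨d, hd⟩ := exists_unitReward_neg_iff.2 (not_le.1 hcon)
    exact absurd (h.1 d) (not_le.2 hd))

theorem PaymentAssumption.maxPayment_le_of_lt_supSafe (hp : PaymentAssumption p) {q : ℝ}
    {s : unitInterval} (h : s < supSafe p q) : (maxPayment p s : ℝ) ≤ q := by
  obtain ⟨s', hs', hlt⟩ := lt_sSup_iff.1 h
  exact (Subtype.coe_le_coe.2 (hp.monotone_maxPayment hlt.le)).trans hs'

/-- Otherwise `supSafe p q` would itself be safe: risky bids lie above it. Against `d` below it they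
win too but pay no less; against larger `d` both it and `s` lose, and `s` is already as good as the
risky bid. -/
theorem PaymentAssumption.lt_maxPayment_supSafe (hp : PaymentAssumption p) {q : ℝ}
    {s : unitInterval} (hs : IsSafeBid p q s) (h : ¬ IsSafeBid p q (supSafe p q)) :
    q < maxPayment p (supSafe p q) := by
  by_contra! hle
  refine h ⟨fun d => ?_, fun b hb d => ?_⟩
  · by_contra! hcon
    exact absurd (exists_unitReward_neg_iff.1 ⟨d, hcon⟩) (not_lt.2 hle)
  · have hlt : supSafe p q < b := by
      by_contra! hcon
      exact absurd ((Subtype.coe_le_coe.2 (hp.monotone_maxPayment hcon)).trans hle)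
        (not_le.2 (exists_unitReward_neg_iff.1 hb))
    by_cases h1 : d ≤ supSafe p q
    · have := Subtype.coe_le_coe.2 (hp.monotone d hlt.le)
      simp only [unitReward, h1, h1.trans hlt.le, if_true]
      exact sub_le_sub_left this q
    · have h2 := hs.2 b hb d
      have h3 : ¬ d ≤ s := fun h => h1 (h.trans (le_supSafe hs))
      simpa [unitReward, h1, h3] using h2

/-- At an exceptional `q`, the monotone function `maxPayment p` jumps at `supSafe p q`, and distinct
exceptional `q` have distinct jump points. Thus the monotone, hence measurable, `supSafe p` needs
correction at only countably many points. -/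
theorem PaymentAssumption.countable_not_isSafeBid_supSafe (hp : PaymentAssumption p) :
    {q : ℝ | (∃ s, IsSafeBid p q s) ∧ ¬ IsSafeBid p q (supSafe p q)}.Countable := by
  set B := {q : ℝ | (∃ s, IsSafeBid p q s) ∧ ¬ IsSafeBid p q (supSafe p q)}
  have hlt : ∀ q ∈ B, ∀ s, IsSafeBid p q s → s < supSafe p q := by
    rintro q ⟨-, hq⟩ s hs
    exact (le_supSafe hs).lt_of_ne fun h => hq (h ▸ hs)
  refine Set.MapsTo.countable_of_injOn (f := supSafe p) (t := {b | ¬ ContinuousAt (maxPayment p) b})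
    ?_ ?_ hp.monotone_maxPayment.countable_not_continuousAt
  · rintro q hq hcont
    obtain ⟨s, hs⟩ := hq.1
    have h1 := hp.lt_maxPayment_supSafe hs hq.2
    have h2 := hlt q hq s hs
    have : (nhdsWithin (supSafe p q) (Set.Iio (supSafe p q))).NeBot :=
      nhdsLT_neBot_of_exists_lt ⟨s, h2⟩
    have h3 : Filter.Tendsto (fun b => (maxPayment p b : ℝ))
        (nhdsWithin (supSafe p q) (Set.Iio (supSafe p q)))
        (nhds (maxPayment p (supSafe p q) : ℝ)) :=
      (continuous_subtype_val.continuousAt.comp hcont).tendsto.mono_left nhdsWithin_le_nhds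
    exact absurd (le_of_tendsto h3 (by
      filter_upwards [self_mem_nhdsWithin] with b hb
      exact hp.maxPayment_le_of_lt_supSafe hb)) (not_le.2 h1)
  · have key : ∀ q ∈ B, ∀ q' ∈ B, supSafe p q = supSafe p q' → ¬ q < q' := by
      intro q hq q' hq' heq hqq
      obtain ⟨s, hs⟩ := hq'.1
      have h1 := hp.lt_maxPayment_supSafe hs hq'.2
      have h2 := hlt q' hq' s hs
      set a := supSafe p q' with ha
      -- Against a competing bid `b` just below `a`, bid `a` wins and `s` loses, so `q' ≤ p a b`.
      -- But `p a b ≤ p b b + (a - b) < q + (q' - q)`, a contradiction.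
      obtain ⟨r, hr1, hr2⟩ := exists_between (max_lt (Subtype.coe_lt_coe.2 h2)
        (sub_lt_self (a : ℝ) (sub_pos.2 hqq)))
      have hr0 : 0 ≤ r := s.2.1.trans ((le_max_left _ _).trans hr1.le)
      have hr0' : r ≤ 1 := hr2.le.trans a.2.2
      let b : unitInterval := ⟨r, hr0, hr0'⟩
      have hba : b < a := Subtype.coe_lt_coe.1 hr2
      have hsb : s < b := Subtype.coe_lt_coe.1 ((le_max_left _ _).trans_lt hr1)
      have h3 := hs.2 a (exists_unitReward_neg_iff.2 h1) b
      simp only [unitReward, hba.le, if_true, not_le.2 hsb, if_false] at h3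
      have h4 := (hp.lipschitz b).dist_le_mul a b
      rw [Subtype.dist_eq, Subtype.dist_eq, Real.dist_eq, Real.dist_eq] at h4
      have h5 : |(a : ℝ) - b| = a - b := abs_of_pos (sub_pos.2 hr2)
      rw [h5] at h4
      have h6 := (abs_le.1 h4).2
      have h7 : (maxPayment p b : ℝ) ≤ q := hp.maxPayment_le_of_lt_supSafe (heq ▸ hba)
      have h8 : ((p b b : unitInterval) : ℝ) ≤ maxPayment p b := by
        by_contra! hcon
        obtain h := (lt_maxPayment_iff (p := p) (q := maxPayment p b) (b := b)).2 ⟨b, le_rfl, hcon⟩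
        exact lt_irrefl _ h
      have h9 : (a : ℝ) - (q' - q) < b := (le_max_right _ _).trans_lt hr1
      simp only [NNReal.coe_one, one_mul] at h6
      linarith
    intro q hq q' hq' heq
    exact le_antisymm (not_lt.1 (key q' hq' q hq heq.symm)) (not_lt.1 (key q hq q' hq' heq))

/-- The safe bid can be chosen measurably in `v, χ, ψ`. -/
theorem PaymentAssumption.exists_measurable_safe (hp : PaymentAssumption p) :
    ∃ safeBid : Context → unitInterval, Measurable safeBid ∧ ∀ c : Context,
      (∀ d, 0 ≤ reward p c d (safeBid c)) ∧
      ∀ b, (∃ d, reward p c d b < 0) → ∀ d, reward p c d b ≤ reward p c d (safeBid c) := by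
  classical
  let σ : ℝ → unitInterval := fun q =>
    if h : (∃ s, IsSafeBid p q s) ∧ ¬ IsSafeBid p q (supSafe p q) then h.1.choose
    else supSafe p q
  have hσ : Measurable σ := by
    refine monotone_supSafe.measurable.measurable_of_countable_ne (f := supSafe p)
      (hp.countable_not_isSafeBid_supSafe.mono fun q hq => ?_)
    by_contra hcon
    rw [Set.mem_ofPred_eq] at hcon
    exact hq (by simp only [σ]; rw [dif_neg hcon])
  have hsafe : ∀ q, (∃ s, IsSafeBid p q s) → IsSafeBid p q (σ q) := by
    intro q hq
    simp only [σ]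
    split_ifs with h
    · exact h.1.choose_spec
    · by_contra hcon
      exact h ⟨hq, hcon⟩
  refine ⟨fun c => σ (c.χ * c.v / c.ψ), hσ.comp ?_, fun c => ?_⟩
  · unfold Context.χ Context.v Context.ψ; fun_prop
  · rcases c.ψ_nonneg.eq_or_lt with h | h
    · have : ∀ d b, ¬ reward p c d b < 0 := fun d b hlt => by
        have := exists_reward_neg_iff.1 ⟨d, hlt⟩
        rw [← h, zero_mul] at this
        exact absurd c.χ_mul_v_nonneg (not_le.2 this)
      exact ⟨fun d => not_lt.1 (this d _), fun b ⟨d, hd⟩ => absurd hd (this d b)⟩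
    · obtain ⟨sb, hsb⟩ := hp.safe
      have := hsafe (c.χ * c.v / c.ψ) ⟨sb c, by
        simpa [IsSafeBid, reward_eq_mul_unitReward h, h, mul_nonneg_iff_of_pos_left,
          mul_neg_iff, h.le, not_lt.2 h.le] using hsb c⟩
      simpa [IsSafeBid, reward_eq_mul_unitReward h, h, mul_nonneg_iff_of_pos_left,
          mul_neg_iff, h.le, not_lt.2 h.le] using this

/-- Replace a bid that may incur a negative reward by the safe bid. -/
noncomputable def guardBid (p : unitInterval → unitInterval → unitInterval)
    (safeBid : Context → unitInterval) (c : Context) (a : unitInterval) : unitInterval :=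
  open Classical in if c.χ * c.v < c.ψ * maxPayment p a then safeBid c else a

theorem measurable_guardBid {safeBid : Context → unitInterval} (hs : Measurable safeBid) (a : unitInterval) :
    Measurable fun c => guardBid p safeBid c a := by
  unfold guardBid
  refine Measurable.ite (measurableSet_lt ?_ ?_) hs measurable_const
  · unfold Context.χ Context.v; fun_prop
  · unfold Context.ψ; fun_prop

theorem reward_le (c : Context) (d b : unitInterval) : reward p c d b ≤ c.χ := by
  unfold reward
  have h1 := c.χ_pos
  have h2 : c.χ * (c.v : ℝ) ≤ c.χ := mul_le_of_le_one_right h1.le c.v.2.2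
  have h3 : 0 ≤ c.ψ * (p b d : ℝ) := mul_nonneg c.ψ_nonneg (p b d).2.1
  split_ifs <;> linarith

theorem reward_le_reward_guardBid {safeBid : Context → unitInterval}
    (hs : ∀ c : Context, (∀ d, 0 ≤ reward p c d (safeBid c)) ∧
      ∀ b, (∃ d, reward p c d b < 0) → ∀ d, reward p c d b ≤ reward p c d (safeBid c))
    (c : Context) (d b : unitInterval) :
    reward p c d b ≤ reward p c d (guardBid p safeBid c b) := by
  unfold guardBid
  split_ifs with h
  · exact (hs c).2 b (exists_reward_neg_iff.2 h) d
  · rfl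

theorem reward_guardBid_nonneg {safeBid : Context → unitInterval}
    (hs : ∀ c : Context, (∀ d, 0 ≤ reward p c d (safeBid c)) ∧
      ∀ b, (∃ d, reward p c d b < 0) → ∀ d, reward p c d b ≤ reward p c d (safeBid c))
    (c : Context) (d b : unitInterval) :
    0 ≤ reward p c d (guardBid p safeBid c b) := by
  unfold guardBid
  split_ifs with h
  · exact (hs c).1 d
  · by_contra! hcon
    exact h (exists_reward_neg_iff.1 ⟨d, hcon⟩)

/-- Raising a guarded bid costs at most `ψ` times the increase. -/
theorem PaymentAssumption.reward_guardBid_le (hp : PaymentAssumption p)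
    {safeBid : Context → unitInterval}
    (hs : ∀ c : Context, (∀ d, 0 ≤ reward p c d (safeBid c)) ∧
      ∀ b, (∃ d, reward p c d b < 0) → ∀ d, reward p c d b ≤ reward p c d (safeBid c))
    (c : Context) (d : unitInterval) {a b : unitInterval} (hab : a ≤ b) :
    reward p c d (guardBid p safeBid c a)
      ≤ reward p c d (guardBid p safeBid c b) + c.ψ * ((b : ℝ) - a) := by
  have hψ : 0 ≤ c.ψ * ((b : ℝ) - a) := mul_nonneg c.ψ_nonneg (sub_nonneg.2 hab)
  by_cases ha : c.χ * c.v < c.ψ * maxPayment p a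
  · have hb : c.χ * c.v < c.ψ * maxPayment p b :=
      ha.trans_le (mul_le_mul_of_nonneg_left
        (Subtype.coe_le_coe.2 (hp.monotone_maxPayment hab)) c.ψ_nonneg)
    simpa [guardBid, ha, hb] using hψ
  · have h1 : guardBid p safeBid c a = a := by simp [guardBid, ha]
    rw [h1]
    by_cases hd : d ≤ a
    · refine le_trans ?_ (add_le_add_left (reward_le_reward_guardBid hs c d b) _)
      have h4 := (hp.lipschitz d).dist_le_mul b a
      rw [Subtype.dist_eq, Subtype.dist_eq, Real.dist_eq, Real.dist_eq,
        abs_of_nonneg (sub_nonneg.2 (Subtype.coe_le_coe.2 hab))] at h4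
      have h5 := (abs_le.1 h4).2
      simp only [NNReal.coe_one, one_mul] at h5
      simp only [reward, hd, hd.trans hab, if_true]
      nlinarith [mul_le_mul_of_nonneg_left h5 c.ψ_nonneg]
    · have : reward p c d a = 0 := by simp [reward, hd]
      rw [this]
      exact add_nonneg (reward_guardBid_nonneg hs c d b) hψ

end SafeBid

/-! ### The law of the random descent and measurability. -/

section TreeLaw

variable {α β : Type*} [MeasurableSpace α] [MeasurableSpace β]

/-- The law of the bid reached by the randomized descent whose value is `treeValue`; grid bid `m`
is played as `g m`. -/
noncomputable def treeLaw (g : ℕ → α) (q : ℕ) (w : ℕ → ℕ → ℕ → ℝ) : ℕ → ℕ → Measure α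
  | 0, m => Measure.dirac (g m)
  | n + 1, m =>
    ENNReal.ofReal (1 - w n (q / blockLength n) m) • treeLaw g q w n m
      + ENNReal.ofReal (w n (q / blockLength n) m) • treeLaw g q w n (m - blockLength n)

theorem isProbabilityMeasure_treeLaw {g : ℕ → α} {q : ℕ} {w : ℕ → ℕ → ℕ → ℝ}
    (hw : ∀ n j m, w n j m ∈ Set.Icc (0 : ℝ) 1) (n m : ℕ) :
    IsProbabilityMeasure (treeLaw g q w n m) := by
  induction n generalizing m with
  | zero => unfold treeLaw; infer_instance
  | succ n ih =>
    have h := hw n (q / blockLength n) m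
    have h1 := ih m
    have h2 := ih (m - blockLength n)
    constructor
    rw [treeLaw]
    simp only [Measure.coe_add, Measure.coe_smul, Pi.add_apply, Pi.smul_apply, measure_univ,
      smul_eq_mul, mul_one]
    rw [← ENNReal.ofReal_add (by linarith [h.2]) h.1]
    simp

theorem integrable_treeLaw {g : ℕ → α} {q : ℕ} {w : ℕ → ℕ → ℕ → ℝ} {f : α → ℝ}
    (hf : Measurable f) (n m : ℕ) : Integrable f (treeLaw g q w n m) := by
  induction n generalizing m with
  | zero => exact integrable_dirac' hf.stronglyMeasurable (by simp)
  | succ n ih =>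
    exact ((ih _).smul_measure ENNReal.ofReal_ne_top).add_measure
      ((ih _).smul_measure ENNReal.ofReal_ne_top)

theorem integral_treeLaw {g : ℕ → α} {q : ℕ} {w : ℕ → ℕ → ℕ → ℝ} {f : α → ℝ}
    (hf : Measurable f) (hw : ∀ n j m, w n j m ∈ Set.Icc (0 : ℝ) 1) (n m : ℕ) :
    ∫ b, f b ∂(treeLaw g q w n m) = treeValue (fun m => f (g m)) q w n m := by
  induction n generalizing m with
  | zero => exact integral_dirac' f _ hf.stronglyMeasurable
  | succ n ih =>
    have h := hw n (q / blockLength n) m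
    rw [treeLaw, treeValue, integral_add_measure
      ((integrable_treeLaw hf _ _).smul_measure ENNReal.ofReal_ne_top)
      ((integrable_treeLaw hf _ _).smul_measure ENNReal.ofReal_ne_top),
      integral_smul_measure, integral_smul_measure, ih, ih,
      ENNReal.toReal_ofReal (by linarith [h.2]), ENNReal.toReal_ofReal h.1]
    rfl

theorem measurable_weight {q : β → ℕ} {w : β → ℕ → ℕ → ℕ → ℝ} (hq : Measurable q)
    (hw : ∀ n j m, Measurable fun b => w b n j m) (n m : ℕ) :
    Measurable fun b => w b n (q b / blockLength n) m := by
  have h : Measurable fun z : ℕ × β => w z.2 n z.1 m :=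
    measurable_from_prod_countable_right fun j => hw n j m
  exact h.comp ((measurable_of_countable (fun i : ℕ => i / blockLength n)).comp hq
    |>.prodMk measurable_id)

theorem measurable_treeLaw {g : β → ℕ → α} {q : β → ℕ} {w : β → ℕ → ℕ → ℕ → ℝ}
    (hg : ∀ m, Measurable fun b => g b m) (hq : Measurable q)
    (hw : ∀ n j m, Measurable fun b => w b n j m) (n m : ℕ) :
    Measurable fun b => treeLaw (g b) (q b) (w b) n m := by
  induction n generalizing m with
  | zero => exact Measure.measurable_dirac.comp (hg m)
  | succ n ih =>
    have h := measurable_weight hq hw n m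
    refine Measure.measurable_of_measurable_coe _ fun s hs => ?_
    have h1 := (Measure.measurable_coe hs).comp (ih m)
    have h2 := (Measure.measurable_coe hs).comp (ih (m - blockLength n))
    simp only [treeLaw, Measure.coe_add, Measure.coe_smul, Pi.add_apply, Pi.smul_apply,
      smul_eq_mul]
    exact ((measurable_const.sub h).ennreal_ofReal.mul h1).add (h.ennreal_ofReal.mul h2)

theorem measurable_treeValue {x : β → ℕ → ℝ} {q : β → ℕ} {w : β → ℕ → ℕ → ℕ → ℝ}
    (hx : ∀ m, Measurable fun b => x b m) (hq : Measurable q)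
    (hw : ∀ n j m, Measurable fun b => w b n j m) (n m : ℕ) :
    Measurable fun b => treeValue (x b) (q b) (w b) n m := by
  induction n generalizing m with
  | zero => exact hx m
  | succ n ih =>
    have h := measurable_weight hq hw n m
    exact ((measurable_const.sub h).mul (ih m)).add (h.mul (ih _))

theorem measurable_treeUpdate {x : β → ℕ → ℝ} {q : β → ℕ} {w : β → ℕ → ℕ → ℕ → ℝ}
    (hx : ∀ m, Measurable fun b => x b m) (hq : Measurable q)
    (hw : ∀ n j m, Measurable fun b => w b n j m) (n j m : ℕ) :
    Measurable fun b => treeUpdate (x b) (q b) (w b) n j m := by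
  have h1 := measurable_treeValue hx hq hw n m
  have h2 := measurable_treeValue hx hq hw n (m - blockLength n)
  unfold treeUpdate treeGap
  refine Measurable.ite ?_ ?_ (hw n j m)
  · exact ((measurable_of_countable fun i : ℕ => i / blockLength n).comp hq)
      (measurableSet_singleton j)
  · exact measurable_const.max (measurable_const.min
      ((hw n j m).sub (measurable_const.mul (h1.sub h2))))

end TreeLaw

/-! ### The bidding algorithm. -/

section Bidder

variable (p : unitInterval → unitInterval → unitInterval) (safeBid : Context → unitInterval)
  (L : ℝ≥0) (K : ℕ)

/-- Index of the value block of width `1 / (L 2 ^ K)` that contains `v`. -/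
noncomputable def blockCoord (v : unitInterval) : ℕ := ⌊(L : ℝ) * v * 2 ^ K⌋₊

/-- The `m`-th multiple of `2⁻ᴷ`, capped at `1`. -/
noncomputable def gridBid (m : ℕ) : unitInterval :=
  Set.projIcc 0 1 zero_le_one ((m : ℝ) / 2 ^ K)

/-- The reward of the guarded `m`-th grid bid, normalized by `u`. -/
noncomputable def gridPayoff (u : ℝ) (c : Context) (d : unitInterval) (m : ℕ) : ℝ :=
  reward p c d (guardBid p safeBid c (gridBid K m)) / u

/-- The running maximum `u` of the multipliers, updated with the context `c`. -/
noncomputable def nextScale (u : ℝ) (c : Context) : ℝ := max u (max c.χ c.ψ)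

/-- The running maximum of the multipliers and the weights of the tree after the given rounds. -/
noncomputable def bidderState : (t : ℕ) → History t → ℝ × (ℕ → ℕ → ℕ → ℝ)
  -- The initial scale `0` is never divided by: `nextScale` includes the current `χ > 0`.
  | 0, _ => (0, fun _ _ _ => 0)
  | t + 1, h =>
    (nextScale (bidderState t (Fin.init h)).1 (h (Fin.last t)).ctx,
      treeUpdate
        (gridPayoff p safeBid K (nextScale (bidderState t (Fin.init h)).1 (h (Fin.last t)).ctx)
          (h (Fin.last t)).ctx (h (Fin.last t)).d)
        (blockCoord L K (h (Fin.last t)).ctx.v) (bidderState t (Fin.init h)).2)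

variable {p safeBid}

theorem bidderState_mem_Icc (t : ℕ) (h : History t) (n j m : ℕ) :
    (bidderState p safeBid L K t h).2 n j m ∈ Set.Icc (0 : ℝ) 1 := by
  induction t generalizing n j m with
  | zero => simp [bidderState]
  | succ t ih => exact treeUpdate_mem_Icc (ih _) n j m

theorem measurable_blockCoord : Measurable (blockCoord L K) := by
  unfold blockCoord
  exact Nat.measurable_floor.comp (by fun_prop)

theorem measurable_reward (hp : Measurable (Function.uncurry p)) :
    Measurable fun z : Context × unitInterval × unitInterval => reward p z.1 z.2.1 z.2.2 := by
  unfold reward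
  refine Measurable.ite (measurableSet_le (by fun_prop) (by fun_prop)) ?_ measurable_const
  have : Measurable fun z : Context × unitInterval × unitInterval => p z.2.2 z.2.1 :=
    hp.comp (f := fun z : Context × unitInterval × unitInterval => (z.2.2, z.2.1)) (by fun_prop)
  unfold Context.χ Context.v Context.ψ
  fun_prop

theorem measurable_nextScale :
    Measurable fun z : ℝ × Context => nextScale z.1 z.2 := by
  unfold nextScale Context.χ Context.ψ
  fun_prop

theorem measurable_gridPayoff (hp : Measurable (Function.uncurry p)) (hs : Measurable safeBid)
    (m : ℕ) :
    Measurable fun z : ℝ × Context × unitInterval =>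
      gridPayoff p safeBid K z.1 z.2.1 z.2.2 m := by
  have h1 := measurable_guardBid (p := p) hs (gridBid K m)
  have h2 := (measurable_reward hp).comp (f := fun z : ℝ × Context × unitInterval =>
    (z.2.1, z.2.2, guardBid p safeBid z.2.1 (gridBid K m))) (by fun_prop)
  exact h2.div measurable_fst

theorem measurable_bidderState (hp : Measurable (Function.uncurry p)) (hs : Measurable safeBid)
    (t : ℕ) :
    (Measurable fun h => (bidderState p safeBid L K t h).1) ∧
      ∀ n j m, Measurable fun h => (bidderState p safeBid L K t h).2 n j m := by
  induction t with
  | zero => exact ⟨measurable_const, fun n j m => measurable_const⟩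
  | succ t ih =>
    have hinit : Measurable fun h : History (t + 1) => (Fin.init h : History t) :=
      measurable_pi_lambda _ fun i => measurable_pi_apply _
    have hlast : Measurable fun h : History (t + 1) => h (Fin.last t) := measurable_pi_apply _
    have hctx : Measurable fun h : History (t + 1) => (h (Fin.last t)).ctx := hlast.fst
    have hd : Measurable fun h : History (t + 1) => (h (Fin.last t)).d := hlast.snd.fst
    have hscale : Measurable fun h : History (t + 1) =>
        nextScale (bidderState p safeBid L K t (Fin.init h)).1 (h (Fin.last t)).ctx :=
      measurable_nextScale.comp ((ih.1.comp hinit).prodMk hctx)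
    refine ⟨hscale, fun n j m => ?_⟩
    exact measurable_treeUpdate
      (fun m => (measurable_gridPayoff K hp hs m).comp (hscale.prodMk (hctx.prodMk hd)))
      ((measurable_blockCoord L K).comp (f := fun h : History (t + 1) => (h (Fin.last t)).ctx.v)
        hctx.fst)
      (fun n j m => (ih.2 n j m).comp hinit) n j m

/-- The bidding algorithm: a randomized descent of `2 K` steps from grid bid `2 ^ (K + 1)`. -/
noncomputable def treeBidder (hs : Measurable safeBid) (hp : Measurable (Function.uncurry p)) :
    BiddingAlgorithm where
  bid t :=
    { toFun := fun z => treeLaw (fun m => guardBid p safeBid z.2 (gridBid K m))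
        (blockCoord L K z.2.v) (bidderState p safeBid L K t z.1).2 (2 * K) (2 * 2 ^ K)
      measurable' := measurable_treeLaw
        (fun m => (measurable_guardBid hs (gridBid K m)).comp measurable_snd)
        ((measurable_blockCoord L K).comp (f := fun z : History t × Context => z.2.v)
          measurable_snd.fst)
        (fun n j m => ((measurable_bidderState L K hp hs t).2 n j m).comp measurable_fst) _ _ }
  markov t := ⟨fun z => isProbabilityMeasure_treeLaw (bidderState_mem_Icc L K t z.1) _ _⟩

end Bidder

/-! ### Concentration of realized around expected rewards. -/

/-- The inverse of `appendRound`. -/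
def splitRound (t : ℕ) (h : History (t + 1)) :
    (History t × Context × unitInterval) × unitInterval :=
  ((Fin.init h, (h (Fin.last t)).ctx, (h (Fin.last t)).d), (h (Fin.last t)).b)

theorem measurable_splitRound (t : ℕ) : Measurable (splitRound t) := by
  have hinit : Measurable fun h : History (t + 1) => (Fin.init h : History t) :=
    measurable_pi_lambda _ fun i => measurable_pi_apply _
  have hlast : Measurable fun h : History (t + 1) => h (Fin.last t) := measurable_pi_apply _
  exact (hinit.prodMk (hlast.fst.prodMk hlast.snd.fst)).prodMk hlast.snd.snd

theorem splitRound_appendRound (t : ℕ)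
    (x : (History t × Context × unitInterval) × unitInterval) :
    splitRound t (appendRound t x) = x := by
  simp [splitRound, appendRound, Round.ctx, Round.d, Round.b]

/-- The sum over the rounds of `a` times the difference between the mean payoff `mean` and the
payoff `X`. -/
noncomputable def deviationSum
    (X : (t : ℕ) → (History t × Context × unitInterval) × unitInterval → ℝ)
    (mean : (t : ℕ) → History t × Context × unitInterval → ℝ) (a : ℕ → ℝ) :
    (t : ℕ) → History t → ℝ
  | 0, _ => 0
  | t + 1, h => deviationSum X mean a t (Fin.init h)
      + a t * (mean t (splitRound t h).1 - X t (splitRound t h))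

section Concentration

variable {X : (t : ℕ) → (History t × Context × unitInterval) × unitInterval → ℝ}
  {mean : (t : ℕ) → History t × Context × unitInterval → ℝ}

theorem measurable_deviationSum (hX : ∀ t, Measurable (X t)) (hmean : ∀ t, Measurable (mean t))
    (a : ℕ → ℝ) (t : ℕ) : Measurable (deviationSum X mean a t) := by
  induction t with
  | zero => exact measurable_const
  | succ t ih =>
    have hs := measurable_splitRound t
    exact (ih.comp hs.fst.fst).add
      (measurable_const.mul (((hmean t).comp hs.fst).sub ((hX t).comp hs)))

/-- Hoeffding's lemma in `lintegral` form. -/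
theorem lintegral_exp_mean_sub_le {Ω : Type*} [MeasurableSpace Ω] {μ : Measure Ω}
    [IsProbabilityMeasure μ] {Y : Ω → ℝ} (hY : Measurable Y) (h1 : ∀ ω, Y ω ∈ Set.Icc (-1 : ℝ) 1)
    (r : ℝ) :
    ∫⁻ ω, ENNReal.ofReal (Real.exp (r * (∫ z, Y z ∂μ - Y ω))) ∂μ
      ≤ ENNReal.ofReal (Real.exp (r ^ 2 / 2)) := by
  have h := hasSubgaussianMGF_of_mem_Icc (μ := μ) hY.aemeasurable (Filter.Eventually.of_forall h1)
  have h3 := h.mgf_le (-r)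
  have h2 := h.integrable_exp_mul (-r)
  have heq : ∀ ω, r * (∫ z, Y z ∂μ - Y ω) = -r * (Y ω - ∫ z, Y z ∂μ) := fun ω => by ring
  simp only [heq]
  rw [← ofReal_integral_eq_lintegral_ofReal h2 (Filter.Eventually.of_forall fun _ =>
    (Real.exp_pos _).le)]
  refine ENNReal.ofReal_le_ofReal (h3.trans (Real.exp_le_exp.2 ?_))
  norm_num

/-- Given the past, the context and `d`, only the bid is random, so by Hoeffding's lemma each round
contributes a factor of at most `exp (r² / 2)`. -/
theorem lintegral_exp_deviationSum_le (alg : BiddingAlgorithm) (adv : AdaptiveAdversary)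
    (hX : ∀ t, Measurable (X t)) (hX1 : ∀ t z, X t z ∈ Set.Icc (-1 : ℝ) 1)
    (hmeas : ∀ t, Measurable (mean t))
    (hmean : ∀ t z, ∫ b, X t (z, b) ∂(alg.bidKernel t z) = mean t z)
    {a : ℕ → ℝ} (ha : ∀ t, |a t| ≤ 1) (r : ℝ) (t : ℕ) :
    ∫⁻ h, ENNReal.ofReal (Real.exp (r * deviationSum X mean a t h)) ∂(playLaw alg adv t)
      ≤ ENNReal.ofReal (Real.exp (t * (r ^ 2 / 2))) := by
  induction t with
  | zero => simp [deviationSum]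
  | succ t ih =>
    have hdev := measurable_deviationSum hX hmeas a
    have hmeasexp : ∀ t, Measurable fun h =>
        ENNReal.ofReal (Real.exp (r * deviationSum X mean a t h)) := fun t =>
      (Real.measurable_exp.comp (measurable_const.mul (hdev t))).ennreal_ofReal
    have hF : Measurable fun x =>
        ENNReal.ofReal (Real.exp (r * deviationSum X mean a (t + 1) (appendRound t x))) :=
      (hmeasexp (t + 1)).comp (measurable_appendRound t)
    have hinner : ∀ z : History t × Context × unitInterval,
        ∫⁻ b, ENNReal.ofReal (Real.exp (r * deviationSum X mean a (t + 1) (appendRound t (z, b))))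
          ∂(alg.bidKernel t z)
        ≤ ENNReal.ofReal (Real.exp (r * deviationSum X mean a t z.1))
          * ENNReal.ofReal (Real.exp (r ^ 2 / 2)) := by
      intro z
      have heq : ∀ b, ENNReal.ofReal
          (Real.exp (r * deviationSum X mean a (t + 1) (appendRound t (z, b))))
          = ENNReal.ofReal (Real.exp (r * deviationSum X mean a t z.1)) *
            ENNReal.ofReal (Real.exp ((r * a t) *
              (∫ b, X t (z, b) ∂(alg.bidKernel t z) - X t (z, b)))) := by
        intro b
        rw [← ENNReal.ofReal_mul (Real.exp_pos _).le, ← Real.exp_add, hmean]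
        have : (Fin.init (appendRound t (z, b)) : History t) = z.1 :=
          congrArg (fun y => y.1.1) (splitRound_appendRound t (z, b))
        rw [deviationSum, splitRound_appendRound, this]
        ring_nf
      simp only [heq]
      have hXz : Measurable fun b => X t (z, b) := (hX t).comp (by fun_prop)
      rw [lintegral_const_mul _ (by
        exact (Real.measurable_exp.comp
          (measurable_const.mul (measurable_const.sub hXz))).ennreal_ofReal)]
      gcongr
      refine (lintegral_exp_mean_sub_le hXz (fun b => hX1 t _) _).trans ?_
      refine ENNReal.ofReal_le_ofReal (Real.exp_le_exp.2 ?_)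
      rw [mul_pow]
      have : a t ^ 2 ≤ 1 := (sq_le_one_iff_abs_le_one _).2 (ha t)
      nlinarith [sq_nonneg r]
    rw [playLaw, lintegral_map (hmeasexp (t + 1)) (measurable_appendRound t),
      Measure.lintegral_compProd hF]
    calc _ ≤ ∫⁻ z, ENNReal.ofReal (Real.exp (r * deviationSum X mean a t z.1))
          * ENNReal.ofReal (Real.exp (r ^ 2 / 2)) ∂((playLaw alg adv t).compProd (adv.pick t)) :=
          lintegral_mono hinner
      _ = (∫⁻ h, ENNReal.ofReal (Real.exp (r * deviationSum X mean a t h)) ∂(playLaw alg adv t))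
          * ENNReal.ofReal (Real.exp (r ^ 2 / 2)) := by
          have hfst : Measurable fun z : History t × Context × unitInterval =>
              ENNReal.ofReal (Real.exp (r * deviationSum X mean a t z.1)) :=
            (hmeasexp t).comp measurable_fst
          rw [lintegral_mul_const _ hfst, Measure.lintegral_compProd hfst]
          simp
      _ ≤ ENNReal.ofReal (Real.exp (t * (r ^ 2 / 2))) * ENNReal.ofReal (Real.exp (r ^ 2 / 2)) := by
          gcongr
      _ = _ := by
          rw [← ENNReal.ofReal_mul (Real.exp_pos _).le, ← Real.exp_add]
          congr 2
          push_cast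
          ring

/-- The Azuma–Hoeffding inequality. -/
theorem measure_deviationSum_ge_le (alg : BiddingAlgorithm) (adv : AdaptiveAdversary)
    (hX : ∀ t, Measurable (X t)) (hX1 : ∀ t z, X t z ∈ Set.Icc (-1 : ℝ) 1)
    (hmeas : ∀ t, Measurable (mean t))
    (hmean : ∀ t z, ∫ b, X t (z, b) ∂(alg.bidKernel t z) = mean t z)
    {a : ℕ → ℝ} (ha : ∀ t, |a t| ≤ 1) {r : ℝ} (hr : 0 ≤ r) (T : ℕ) (M : ℝ) :
    playLaw alg adv T {h | M ≤ deviationSum X mean a T h}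
      ≤ ENNReal.ofReal (Real.exp (T * (r ^ 2 / 2) - r * M)) := by
  have h1 := lintegral_exp_deviationSum_le alg adv hX hX1 hmeas hmean ha r T
  have hm : Measurable fun h => ENNReal.ofReal (Real.exp (r * deviationSum X mean a T h)) :=
    (Real.measurable_exp.comp
      (measurable_const.mul (measurable_deviationSum hX hmeas a T))).ennreal_ofReal
  have h2 := mul_meas_ge_le_lintegral (μ := playLaw alg adv T) hm
    (ENNReal.ofReal (Real.exp (r * M)))
  have hpos : 0 < Real.exp (r * M) := Real.exp_pos _
  have h3 : playLaw alg adv T {h | M ≤ deviationSum X mean a T h} ≤ playLaw alg adv T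
      {h | ENNReal.ofReal (Real.exp (r * M))
        ≤ ENNReal.ofReal (Real.exp (r * deviationSum X mean a T h))} := by
    refine measure_mono fun h hh => ENNReal.ofReal_le_ofReal (Real.exp_le_exp.2 ?_)
    exact mul_le_mul_of_nonneg_left hh hr
  rw [Real.exp_sub, ENNReal.ofReal_div_of_pos hpos,
    ENNReal.le_div_iff_mul_le (Or.inl (ENNReal.ofReal_pos.2 hpos).ne')
      (Or.inl ENNReal.ofReal_ne_top), mul_comm]
  calc _ ≤ _ := mul_le_mul_right h3 _
    _ ≤ _ := h2.trans h1

/-- Simultaneous concentration on all intervals of rounds. -/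
theorem exists_measurableSet_deviationSum_le (alg : BiddingAlgorithm) (adv : AdaptiveAdversary)
    (hX : ∀ t, Measurable (X t)) (hX1 : ∀ t z, X t z ∈ Set.Icc (-1 : ℝ) 1)
    (hmeas : ∀ t, Measurable (mean t))
    (hmean : ∀ t z, ∫ b, X t (z, b) ∂(alg.bidKernel t z) = mean t z)
    {T : ℕ} (hT : 2 ≤ T) {δ : ℝ} (hδ : 0 < δ) (hδ1 : δ < 1) :
    ∃ E : Set (History T), MeasurableSet E ∧ ENNReal.ofReal (1 - δ) ≤ playLaw alg adv T E ∧
      ∀ h ∈ E, ∀ s < T, ∀ e < T,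
        deviationSum X mean (fun t => if t ∈ Finset.Ico s (e + 1) then 1 else 0) T h
          ≤ 2 * √(T * Real.log (T / δ)) := by
  set M := 2 * √(T * Real.log (T / δ)) with hM
  set S := fun (i : ℕ × ℕ) => deviationSum X mean
    (fun t => if t ∈ Finset.Ico i.1 (i.2 + 1) then 1 else 0) T with hS
  set I := Finset.range T ×ˢ Finset.range T with hI
  have hSm : ∀ i, Measurable (S i) := fun i => measurable_deviationSum hX hmeas _ T
  set B := ⋃ i ∈ I, {h | M ≤ S i h} with hB
  have hBm : MeasurableSet B := Finset.measurableSet_biUnion _ fun i _ =>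
    measurableSet_le measurable_const (hSm i)
  have hTpos : (0 : ℝ) < T := by positivity
  have hT1 : (1 : ℝ) ≤ T := by exact_mod_cast (by omega : 1 ≤ T)
  have hℓ : 0 < Real.log (T / δ) := Real.log_pos (by rw [lt_div_iff₀ hδ]; linarith)
  set ℓ := Real.log (T / δ)
  have hone : ∀ i, playLaw alg adv T {h | M ≤ S i h} ≤ ENNReal.ofReal ((δ / T) ^ 2) := by
    intro i
    -- This `r` makes the exponent `2ℓ - 4ℓ = -2ℓ`; the `T²` pairs of endpoints then fail with total
    -- probability at most `δ² ≤ δ`.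
    refine (measure_deviationSum_ge_le alg adv hX hX1 hmeas hmean
      (fun t => by split_ifs <;> simp) (r := 2 * √(ℓ / T)) (by positivity) T M).trans ?_
    refine ENNReal.ofReal_le_ofReal ?_
    have e1 : (2 * √(ℓ / T)) ^ 2 = 4 * (ℓ / T) := by
      rw [mul_pow, Real.sq_sqrt (by positivity)]; norm_num
    have e2 : 2 * √(ℓ / T) * M = 4 * ℓ := by
      have : √(ℓ / T) * √(T * ℓ) = ℓ := by
        rw [← Real.sqrt_mul (by positivity),
          show ℓ / T * (T * ℓ) = ℓ ^ 2 by field_simp, Real.sqrt_sq hℓ.le]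
      rw [hM]; linear_combination 4 * this
    rw [e1, e2]
    have e3 : (δ / T) ^ 2 = Real.exp (-(2 * ℓ)) := by
      rw [Real.exp_neg, two_mul, Real.exp_add, Real.exp_log (by positivity)]
      field_simp
    rw [e3, Real.exp_le_exp]
    have : T * (4 * (ℓ / T) / 2) = 2 * ℓ := by field_simp; ring
    rw [this]; linarith
  have hBle : playLaw alg adv T B ≤ ENNReal.ofReal δ := by
    calc _ ≤ ∑ i ∈ I, playLaw alg adv T {h | M ≤ S i h} := measure_biUnion_finset_le _ _
      _ ≤ ∑ _i ∈ I, ENNReal.ofReal ((δ / T) ^ 2) := Finset.sum_le_sum fun i _ => hone i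
      _ = ENNReal.ofReal (δ ^ 2) := by
          rw [Finset.sum_const, hI, Finset.card_product, Finset.card_range, nsmul_eq_mul,
            ← ENNReal.ofReal_natCast, ← ENNReal.ofReal_mul (by positivity)]
          congr 1
          push_cast
          field_simp
      _ ≤ _ := ENNReal.ofReal_le_ofReal (by nlinarith)
  refine ⟨Bᶜ, hBm.compl, ?_, fun h hh s hs e he => ?_⟩
  · rw [prob_compl_eq_one_sub hBm, ENNReal.ofReal_sub _ hδ.le, ENNReal.ofReal_one]
    exact tsub_le_tsub_left hBle _
  · by_contra! hcon
    refine hh (Set.mem_biUnion (x := (s, e)) ?_ hcon.le)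
    simp [hI, hs, he]

end Concentration

/-! ### Discretization and expected regret. -/

section Regret

variable {p : unitInterval → unitInterval → unitInterval} {safeBid : Context → unitInterval}

theorem gridBid_mono (K : ℕ) : Monotone (gridBid K) := fun a b h =>
  Set.monotone_projIcc _ (by gcongr)

theorem gridBid_sub_le (K m k : ℕ) :
    (gridBid K m : ℝ) - gridBid K (m - k) ≤ k * (1 / 2 ^ K) := by
  have h := Set.abs_projIcc_sub_projIcc (α := ℝ) (a := 0) (b := 1)
    (c := (m : ℝ) / 2 ^ K) (d := ((m - k : ℕ) : ℝ) / 2 ^ K) zero_le_one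
  refine (le_abs_self _).trans (h.trans ?_)
  rw [← sub_div, abs_div, abs_of_pos (by positivity : (0 : ℝ) < 2 ^ K), mul_one_div]
  gcongr
  have h1 : (m : ℝ) ≤ (m - k : ℕ) + k := by exact_mod_cast (by omega : m ≤ m - k + k)
  have h2 : ((m - k : ℕ) : ℝ) ≤ m := by exact_mod_cast Nat.sub_le m k
  rw [abs_of_nonneg (by linarith)]
  linarith

theorem gridPayoff_mem_Icc
    (hs : ∀ c : Context, (∀ d, 0 ≤ reward p c d (safeBid c)) ∧
      ∀ b, (∃ d, reward p c d b < 0) → ∀ d, reward p c d b ≤ reward p c d (safeBid c))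
    (K : ℕ) {u : ℝ} {c : Context} (hu : max c.χ c.ψ ≤ u) (d : unitInterval) (m : ℕ) :
    gridPayoff p safeBid K u c d m ∈ Set.Icc (0 : ℝ) 1 := by
  have h1 : c.χ ≤ u := (le_max_left _ _).trans hu
  have h2 : 0 < u := c.χ_pos.trans_le h1
  refine ⟨div_nonneg (reward_guardBid_nonneg hs c d _) h2.le, ?_⟩
  rw [gridPayoff, div_le_one h2]
  exact (reward_le c d _).trans h1

/-- The normalized reward of a guarded bid drops by at most the amount by which it is raised. -/
theorem PaymentAssumption.reward_guardBid_div_le (hp : PaymentAssumption p)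
    (hs : ∀ c : Context, (∀ d, 0 ≤ reward p c d (safeBid c)) ∧
      ∀ b, (∃ d, reward p c d b < 0) → ∀ d, reward p c d b ≤ reward p c d (safeBid c))
    {u : ℝ} {c : Context} (hu : max c.χ c.ψ ≤ u) (d : unitInterval) {a b : unitInterval}
    (hab : a ≤ b) :
    reward p c d (guardBid p safeBid c a) / u
      ≤ reward p c d (guardBid p safeBid c b) / u + ((b : ℝ) - a) := by
  have h2 : 0 < u := c.χ_pos.trans_le ((le_max_left _ _).trans hu)
  rw [div_add' _ _ _ h2.ne']
  gcongr
  have h3 := hp.reward_guardBid_le hs c d hab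
  have h4 : 0 ≤ (b : ℝ) - a := sub_nonneg.2 hab
  nlinarith [(le_max_right c.χ c.ψ).trans hu]

/-- Discretization of a Lipschitz bidding function on the value blocks. -/
theorem exists_descends_of_lipschitz {L : ℝ≥0} (hL : 1 ≤ L) (K : ℕ)
    {f : unitInterval → unitInterval} (hf : LipschitzWith L f) :
    ∃ c : ℕ → ℕ, Descends (2 * K) (fun _ => 2 * 2 ^ K) c ∧
      ∀ v, f v ≤ gridBid K (c (blockCoord L K v)) ∧
        (gridBid K (c (blockCoord L K v)) : ℝ) - f v ≤ 5 * (1 / 2 ^ K) := by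
  have hL0 : (0 : ℝ) < L := by
    have : (1 : ℝ) ≤ L := by exact_mod_cast hL
    linarith
  have hK : (0 : ℝ) < 2 ^ K := by positivity
  set point : ℝ → unitInterval := fun r => Set.projIcc 0 1 zero_le_one (r / (L * 2 ^ K))
    with hpoint
  have hclose : ∀ r r' : ℝ, 2 ^ K * (f (point r) : ℝ) ≤ 2 ^ K * f (point r') + |r - r'| := by
    intro r r'
    have h1 := hf.dist_le_mul (point r) (point r')
    have h2 := Set.abs_projIcc_sub_projIcc (α := ℝ) (a := 0) (b := 1)
      (c := r / (L * 2 ^ K)) (d := r' / (L * 2 ^ K)) zero_le_one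
    rw [← sub_div, abs_div, abs_of_pos (by positivity : (0 : ℝ) < L * 2 ^ K)] at h2
    rw [Subtype.dist_eq, Subtype.dist_eq, Real.dist_eq, Real.dist_eq] at h1
    have h3 : (L : ℝ) * (|r - r'| / (L * 2 ^ K)) = |r - r'| / 2 ^ K := by field_simp
    have h4 := (le_abs_self _).trans (h1.trans (mul_le_mul_of_nonneg_left h2 hL0.le))
    rw [h3, le_div_iff₀ hK] at h4
    linarith
  -- The extra `1` keeps the grid bid above `f` on the whole value block. The error of five grid
  -- steps is this `1`, rounding up, variation of `f` within the block, and `2` from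
  -- `exists_descends`.
  set F : ℕ → ℕ := fun i => ⌈2 ^ K * (f (point i) : ℝ)⌉₊ + 1 with hFdef
  have hF : ∀ n i j, i / blockLength n = j / blockLength n → F i ≤ F j + blockLength n := by
    intro n i j hij
    have h1 := hclose i j
    have hi := Nat.div_add_mod i (blockLength n)
    have hj := Nat.div_add_mod j (blockLength n)
    have hi' := Nat.mod_lt i (blockLength_pos n)
    have hj' := Nat.mod_lt j (blockLength_pos n)
    rw [hij] at hi
    have h2 : |(i : ℝ) - j| ≤ blockLength n := by
      rw [abs_le]
      constructor
      · have : (j : ℝ) ≤ i + blockLength n := by exact_mod_cast (by omega)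
        linarith
      · have : (i : ℝ) ≤ j + blockLength n := by exact_mod_cast (by omega)
        linarith
    have h3 : ⌈2 ^ K * (f (point i) : ℝ)⌉₊ ≤ ⌈2 ^ K * (f (point j) : ℝ)⌉₊ + blockLength n := by
      rw [Nat.ceil_le]
      push_cast
      have := Nat.le_ceil (2 ^ K * (f (point j) : ℝ))
      linarith
    simp only [hFdef]
    omega
  have hFle : ∀ i, F i ≤ 2 * 2 ^ K := by
    intro i
    have h1 : ⌈2 ^ K * (f (point i) : ℝ)⌉₊ ≤ 2 ^ K := by
      rw [Nat.ceil_le]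
      push_cast
      exact mul_le_of_le_one_right hK.le (f (point i)).2.2
    have h2 := Nat.one_le_two_pow (n := K)
    simp only [hFdef]
    omega
  obtain ⟨c, hc, hcF⟩ := exists_descends hF (2 * K) (fun _ => 2 * 2 ^ K) (fun _ _ _ => rfl) hFle
    -- The starting bid is the sum of all block lengths plus `2`, so this constraint holds however
    -- small `F` is.
    (fun i => by rw [sum_blockLength_two_mul]; exact Nat.le_add_left _ _)
  refine ⟨c, hc, fun v => ?_⟩
  set i := blockCoord L K v with hi
  have hv : point (L * v * 2 ^ K) = v := by
    rw [hpoint]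
    simp only
    rw [show (L : ℝ) * v * 2 ^ K / (L * 2 ^ K) = v by field_simp]
    exact Set.projIcc_val zero_le_one v
  have h0 : (0 : ℝ) ≤ L * v * 2 ^ K := mul_nonneg (mul_nonneg hL0.le v.2.1) hK.le
  have h1 : (i : ℝ) ≤ L * v * 2 ^ K := Nat.floor_le h0
  have h2 : (L : ℝ) * v * 2 ^ K < i + 1 := Nat.lt_floor_add_one _
  have h3 : |(L : ℝ) * v * 2 ^ K - i| ≤ 1 := by rw [abs_le]; constructor <;> linarith
  have h4 := hclose (L * v * 2 ^ K) i
  have h5 := hclose i (L * v * 2 ^ K)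
  rw [abs_sub_comm] at h5
  rw [hv] at h4 h5
  have h6 := Nat.le_ceil (2 ^ K * (f (point i) : ℝ))
  have h7 := (Nat.ceil_lt_add_one (a := 2 ^ K * (f (point i) : ℝ))
    (mul_nonneg hK.le (f (point i)).2.1)).le
  have hFi : (F i : ℝ) = ⌈2 ^ K * (f (point i) : ℝ)⌉₊ + 1 := by
    simp only [hFdef, Nat.cast_add, Nat.cast_one]
  have h8 : (F i : ℝ) ≤ c i := by exact_mod_cast (hcF i).1
  have h9 : (c i : ℝ) ≤ F i + 2 := by exact_mod_cast (hcF i).2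
  rw [hFi] at h8 h9
  have hlow : (f v : ℝ) ≤ c i / 2 ^ K := by
    rw [le_div_iff₀ hK]; linarith
  have hup : (c i : ℝ) / 2 ^ K ≤ f v + 5 * (1 / 2 ^ K) := by
    rw [div_le_iff₀ hK, add_mul]
    field_simp
    linarith
  have hcoe : (gridBid K (c i) : ℝ) = max 0 (min 1 ((c i : ℝ) / 2 ^ K)) :=
    Set.coe_projIcc _ _ _ _
  constructor
  · rw [← Subtype.coe_le_coe, hcoe]
    exact le_max_of_le_right (le_min (f v).2.2 hlow)
  · rw [hcoe]
    have : max 0 (min 1 ((c i : ℝ) / 2 ^ K)) ≤ (c i : ℝ) / 2 ^ K :=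
      max_le (by positivity) (min_le_right _ _)
    linarith

/-- A resolution that balances the discretization error against the number of blocks. -/
theorem exists_resolution (L T : ℝ) :
    ∃ K : ℕ, 0 < L → L ≤ T → √(T / L) ≤ 2 ^ K ∧ 2 ^ K ≤ 2 * √(T / L) := by
  by_cases h : 0 < L ∧ L ≤ T
  · obtain ⟨n, h1, h2⟩ := exists_nat_pow_near (x := √(T / L)) (y := 2)
      (by rw [Real.one_le_sqrt, one_le_div h.1]; exact h.2) one_lt_two
    exact ⟨n + 1, fun _ _ => ⟨h2.le, by rw [pow_succ]; linarith⟩⟩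
  · exact ⟨0, fun h1 h2 => absurd ⟨h1, h2⟩ h⟩

theorem log_two_mul_le {T : ℕ} (hT : 2 ≤ T) : 1 ≤ 2 * Real.log T := by
  have h1 : Real.log 2 ≤ Real.log T := Real.log_le_log two_pos (by exact_mod_cast hT)
  linarith [Real.log_two_gt_d9]

/-- The regret of the expected normalized reward on every interval of rounds, for normalizations
that dominate the multipliers. -/
theorem PaymentAssumption.treeValue_gridPayoff_regret (hp : PaymentAssumption p)
    (hs : ∀ c : Context, (∀ d, 0 ≤ reward p c d (safeBid c)) ∧
      ∀ b, (∃ d, reward p c d b < 0) → ∀ d, reward p c d b ≤ reward p c d (safeBid c))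
    {L : ℝ≥0} (hL : 1 ≤ L) {T K : ℕ} (hT : 2 ≤ T)
    (hK : 0 < (L : ℝ) → (L : ℝ) ≤ T → √(T / L) ≤ 2 ^ K ∧ 2 ^ K ≤ 2 * √(T / L))
    (ω : ℕ → Round) (u : ℕ → ℝ) (hu : ∀ t, max (ω t).ctx.χ (ω t).ctx.ψ ≤ u t)
    (w : ℕ → ℕ → ℕ → ℕ → ℝ) (hw : ∀ t n j m, w t n j m ∈ Set.Icc (0 : ℝ) 1)
    (hstep : ∀ t, w (t + 1) = treeUpdate (gridPayoff p safeBid K (u t) (ω t).ctx (ω t).d)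
      (blockCoord L K (ω t).ctx.v) (w t))
    {s e : ℕ} (hse : s ≤ e) (heT : e ≤ T) {f : unitInterval → unitInterval}
    (hf : LipschitzWith L f) :
    ∑ t ∈ Finset.Ico s e, (reward p (ω t).ctx (ω t).d (f (ω t).ctx.v) / u t
        - treeValue (gridPayoff p safeBid K (u t) (ω t).ctx (ω t).d)
          (blockCoord L K (ω t).ctx.v) (w t) (2 * K) (2 * 2 ^ K))
      ≤ (84 * Real.exp 8 + 10) * (√(L * T) * Real.log T) := by
  have hL1 : (1 : ℝ) ≤ L := by exact_mod_cast hL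
  have hL0 : (0 : ℝ) < L := by linarith
  have hlog := log_two_mul_le hT
  have hu0 : ∀ t, 0 < u t := fun t =>
    (ω t).ctx.χ_pos.trans_le ((le_max_left _ _).trans (hu t))
  have hx := fun t => gridPayoff_mem_Icc hs K (hu t) (ω t).d
  have hesT : ((e - s : ℕ) : ℝ) ≤ T := by exact_mod_cast (by omega : e - s ≤ T)
  have hT0 : (0 : ℝ) < T := by positivity
  have he8 : 0 < Real.exp 8 := Real.exp_pos _
  rcases lt_or_ge (T : ℝ) L with hLT | hLT
  -- If `L > T`, the trivial regret of `1` per round suffices, since `T ≤ √(LT)`.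
  · have h1 : ∀ t ∈ Finset.Ico s e, reward p (ω t).ctx (ω t).d (f (ω t).ctx.v) / u t
        - treeValue (gridPayoff p safeBid K (u t) (ω t).ctx (ω t).d)
          (blockCoord L K (ω t).ctx.v) (w t) (2 * K) (2 * 2 ^ K) ≤ 1 := by
      intro t _
      have e1 := (treeValue_mem_Icc (q := blockCoord L K (ω t).ctx.v) (hx t) (hw t)
        (2 * K) (2 * 2 ^ K)).1
      have e2 : reward p (ω t).ctx (ω t).d (f (ω t).ctx.v) / u t ≤ 1 := by
        rw [div_le_one (hu0 t)]
        exact (reward_le _ _ _).trans ((le_max_left _ _).trans (hu t))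
      linarith
    have h2 := Finset.sum_le_sum h1
    rw [Finset.sum_const, Nat.card_Ico, nsmul_one] at h2
    have h3 : (T : ℝ) ≤ √(L * T) := Real.le_sqrt_of_sq_le (by nlinarith)
    have h4 : (T : ℝ) ≤ √(L * T) * (2 * Real.log T) :=
      h3.trans (le_mul_of_one_le_right (Real.sqrt_nonneg _) hlog)
    have h5 : 0 ≤ √(L * T) * Real.log T := mul_nonneg (Real.sqrt_nonneg _) (by linarith)
    nlinarith
  · obtain ⟨hK1, hK2⟩ := hK hL0 hLT
    set g := √((T : ℝ) / L) with hg
    have hg1 : 1 ≤ g := by rw [hg, Real.one_le_sqrt, one_le_div hL0]; exact hLT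
    have hgT : (T : ℝ) = L * g ^ 2 := by
      rw [hg, Real.sq_sqrt (by positivity)]; field_simp
    have hR : √((L : ℝ) * T) = L * g := by
      rw [hgT, show (L : ℝ) * (L * g ^ 2) = (L * g) ^ 2 by ring,
        Real.sqrt_sq (by positivity)]
    rw [hR]
    set R := (L : ℝ) * g with hRdef
    have hR0 : 0 < R := by positivity
    have hεT : 1 / 2 ^ K * (T : ℝ) ≤ R := by
      rw [one_div, inv_mul_le_iff₀ (by positivity), hgT, hRdef]
      nlinarith
    have hεes : 1 / 2 ^ K * ((e - s : ℕ) : ℝ) ≤ R :=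
      (mul_le_mul_of_nonneg_left hesT (by positivity)).trans hεT
    obtain ⟨c, hc, hcf⟩ := exists_descends_of_lipschitz hL K hf
    set x := fun t => gridPayoff p safeBid K (u t) (ω t).ctx (ω t).d with hxdef
    set q := fun t => blockCoord L K (ω t).ctx.v with hqdef
    -- `14 = 6 + 8`: the blocks cost `3/2 (L 2ᴷ + D) ≤ 3 L 2ᴷ ≤ 6R` and the discretization term is
    -- `8εT ≤ 8R`.
    have htree := treeValue_regret (x := x) (q := q) (w := w) (Q := ⌊(L : ℝ) * 2 ^ K⌋₊)
      (s := s) (e := e) (ε := 1 / 2 ^ K) (R := 14 * R) (by positivity) (by positivity) hse hx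
      (fun t m k => by
        refine (hp.reward_guardBid_div_le hs (hu t) (ω t).d
          (gridBid_mono K (Nat.sub_le m k))).trans ?_
        exact add_le_add_right (gridBid_sub_le K m k) _)
      hw (fun t _ => hstep t)
      (fun t _ => by
        refine Nat.floor_le_floor ?_
        have := (ω t).ctx.v.2.2
        have h2 : (L : ℝ) * (ω t).ctx.v ≤ L := mul_le_of_le_one_right hL0.le this
        gcongr) (2 * K) (2 * K) le_rfl
      (by
        intro n hn
        set D := blockLength n with hD
        have hD1 : (1 : ℝ) ≤ D := by exact_mod_cast blockLength_pos n
        have hDK : (D : ℝ) ≤ 2 ^ K := by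
          rw [hD, blockLength]
          push_cast
          exact pow_le_pow_right₀ one_le_two (by omega)
        have h1 : ((⌊(L : ℝ) * 2 ^ K⌋₊ / D + 1 : ℕ) : ℝ) ≤ L * 2 ^ K / D + 1 := by
          push_cast
          gcongr
          exact Nat.cast_div_le.trans (by gcongr; exact Nat.floor_le (by positivity))
        have h2 : ((⌊(L : ℝ) * 2 ^ K⌋₊ / D + 1 : ℕ) : ℝ) * (D / 2 + 1)
            ≤ (L * 2 ^ K / D + 1) * (3 / 2 * D) := by
          gcongr
          linarith
        have h3 : ((L : ℝ) * 2 ^ K / D + 1) * (3 / 2 * D) = 3 / 2 * (L * 2 ^ K + D) := by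
          field_simp
        have h4 : (2 : ℝ) ^ K ≤ L * 2 ^ K := le_mul_of_one_le_left (by positivity) hL1
        have h5 : (L : ℝ) * 2 ^ K ≤ 2 * R := by rw [hRdef]; nlinarith
        linarith)
      (fun _ => 2 * 2 ^ K) c (fun _ _ _ => rfl) hc
    have hround : ∀ t ∈ Finset.Ico s e,
        reward p (ω t).ctx (ω t).d (f (ω t).ctx.v) / u t
          - treeValue (x t) (q t) (w t) (2 * K) (2 * 2 ^ K)
        ≤ (x t (c (q t)) - treeValue (x t) (q t) (w t) (2 * K) (2 * 2 ^ K))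
          + 5 * (1 / 2 ^ K) := by
      intro t _
      obtain ⟨e1, e2⟩ := hcf (ω t).ctx.v
      have e3 := hp.reward_guardBid_div_le hs (hu t) (ω t).d e1
      have e4 : reward p (ω t).ctx (ω t).d (f (ω t).ctx.v) / u t
          ≤ reward p (ω t).ctx (ω t).d (guardBid p safeBid (ω t).ctx (f (ω t).ctx.v)) / u t :=
        div_le_div_of_nonneg_right (reward_le_reward_guardBid hs _ _ _) (hu0 t).le
      have e5 : x t (c (q t)) = reward p (ω t).ctx (ω t).d
        (guardBid p safeBid (ω t).ctx (gridBid K (c (blockCoord L K (ω t).ctx.v)))) / u t := rfl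
      linarith
    have hsum := Finset.sum_le_sum hround
    rw [Finset.sum_add_distrib, Finset.sum_const, Nat.card_Ico, nsmul_eq_mul] at hsum
    have hKlog : (K : ℝ) ≤ 3 * Real.log T := by
      have h1 : (2 : ℝ) ^ K ≤ 2 * T := by
        refine hK2.trans ?_
        rw [hgT]
        nlinarith
      have h2 := Real.log_le_log (by positivity) h1
      rw [Real.log_pow, Real.log_mul two_ne_zero hT0.ne'] at h2
      have h3 : Real.log 2 ≤ Real.log T := Real.log_le_log two_pos (by exact_mod_cast hT)
      have h4 := Real.log_two_gt_d9
      nlinarith [(Nat.cast_nonneg K : (0 : ℝ) ≤ K)]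
    have hexp : Real.exp (2 * ∑ j ∈ Finset.range (2 * K), (1 : ℝ) / blockLength j)
        ≤ Real.exp 8 :=
      Real.exp_le_exp.2 (by linarith [sum_inv_blockLength_le K])
    have htree' := htree.trans (mul_le_mul_of_nonneg_right hexp (by positivity))
    push_cast at htree'
    -- `84 = 6 · 14`, since there are `2K ≤ 6 log T` heights.
    have h1 : Real.exp 8 * (2 * K * (14 * R)) ≤ 84 * Real.exp 8 * (R * Real.log T) := by
      have : 0 ≤ Real.exp 8 * R := by positivity
      nlinarith
    have h2 : ((e - s : ℕ) : ℝ) * (5 * (1 / 2 ^ K)) ≤ 10 * (R * Real.log T) := by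
      have : R ≤ R * (2 * Real.log T) := le_mul_of_one_le_right hR0.le hlog
      linarith
    refine hsum.trans ?_
    rw [add_mul]
    exact add_le_add (htree'.trans h1) h2

end Regret

/-! ### Realized regret and the main theorem. -/

theorem deviationSum_prefix
    (X : (t : ℕ) → (History t × Context × unitInterval) × unitInterval → ℝ)
    (mean : (t : ℕ) → History t × Context × unitInterval → ℝ) (a : ℕ → ℝ) (ω : ℕ → Round)
    (t : ℕ) :
    deviationSum X mean a t (fun i => ω i) = ∑ i ∈ Finset.range t,
      a i * (mean i (fun j => ω j, (ω i).ctx, (ω i).d)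
        - X i ((fun j => ω j, (ω i).ctx, (ω i).d), (ω i).b)) := by
  induction t with
  | zero => rfl
  | succ t ih =>
    rw [Finset.sum_range_succ, ← ih]
    rfl

section Play

variable (p : unitInterval → unitInterval → unitInterval) (safeBid : Context → unitInterval)
  (L : ℝ≥0) (K : ℕ)

/-- The running maximum of the multipliers, including the current context. -/
noncomputable def currentScale (t : ℕ) (z : History t × Context × unitInterval) : ℝ :=
  nextScale (bidderState p safeBid L K t z.1).1 z.2.1

/-- The reward of a bid, normalized by the running maximum of the multipliers. -/
noncomputable def normalizedReward (t : ℕ)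
    (z : (History t × Context × unitInterval) × unitInterval) : ℝ :=
  reward p z.1.2.1 z.1.2.2 z.2 / currentScale p safeBid L K t z.1

/-- The expected normalized reward of the bidder. -/
noncomputable def expectedReward (t : ℕ) (z : History t × Context × unitInterval) : ℝ :=
  treeValue (gridPayoff p safeBid K (currentScale p safeBid L K t z) z.2.1 z.2.2)
    (blockCoord L K z.2.1.v) (bidderState p safeBid L K t z.1).2 (2 * K) (2 * 2 ^ K)

variable {p safeBid}

theorem measurable_currentScale (hp : Measurable (Function.uncurry p))
    (hs : Measurable safeBid) (t : ℕ) : Measurable (currentScale p safeBid L K t) :=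
  measurable_nextScale.comp
    (((measurable_bidderState L K hp hs t).1.comp measurable_fst).prodMk measurable_snd.fst)

theorem measurable_normalizedReward (hp : Measurable (Function.uncurry p))
    (hs : Measurable safeBid) (t : ℕ) : Measurable (normalizedReward p safeBid L K t) :=
  ((measurable_reward hp).comp
    (measurable_fst.snd.fst.prodMk (measurable_fst.snd.snd.prodMk measurable_snd))).div
    ((measurable_currentScale L K hp hs t).comp measurable_fst)

theorem measurable_expectedReward (hp : Measurable (Function.uncurry p))
    (hs : Measurable safeBid) (t : ℕ) : Measurable (expectedReward p safeBid L K t) :=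
  measurable_treeValue
    (fun m => (measurable_gridPayoff K hp hs m).comp
      ((measurable_currentScale L K hp hs t).prodMk measurable_snd))
    ((measurable_blockCoord L K).comp
      (f := fun z : History t × Context × unitInterval => z.2.1.v) measurable_snd.fst.fst)
    (fun n j m => ((measurable_bidderState L K hp hs t).2 n j m).comp measurable_fst) _ _

theorem neg_ψ_le_reward (c : Context) (d b : unitInterval) : -c.ψ ≤ reward p c d b := by
  unfold reward
  have h2 := c.χ_mul_v_nonneg
  have h3 : c.ψ * (p b d : ℝ) ≤ c.ψ := mul_le_of_le_one_right c.ψ_nonneg (p b d).2.2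
  have h4 := c.ψ_nonneg
  split_ifs <;> linarith

theorem max_multiplier_le_nextScale (u : ℝ) (c : Context) : max c.χ c.ψ ≤ nextScale u c :=
  le_max_right _ _

theorem normalizedReward_mem_Icc (t : ℕ)
    (z : (History t × Context × unitInterval) × unitInterval) :
    normalizedReward p safeBid L K t z ∈ Set.Icc (-1 : ℝ) 1 := by
  have h1 : max z.1.2.1.χ z.1.2.1.ψ ≤ currentScale p safeBid L K t z.1 :=
    max_multiplier_le_nextScale _ _
  have h2 : 0 < currentScale p safeBid L K t z.1 :=
    z.1.2.1.χ_pos.trans_le ((le_max_left _ _).trans h1)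
  rw [normalizedReward]
  constructor
  · rw [le_div_iff₀ h2]
    linarith [neg_ψ_le_reward (p := p) z.1.2.1 z.1.2.2 z.2,
      (le_max_right z.1.2.1.χ z.1.2.1.ψ).trans h1]
  · rw [div_le_one h2]
    exact (reward_le _ _ _).trans ((le_max_left _ _).trans h1)

/-- The bid is drawn independently of the current `d`, so its mean reward for any given `d` is the
tree value of the payoffs for that `d`. -/
theorem integral_normalizedReward (hp : Measurable (Function.uncurry p))
    (hs : Measurable safeBid) (t : ℕ) (z : History t × Context × unitInterval) :
    ∫ b, normalizedReward p safeBid L K t (z, b) ∂((treeBidder L K hs hp).bidKernel t z)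
      = expectedReward p safeBid L K t z := by
  have hm : Measurable fun b => normalizedReward p safeBid L K t (z, b) :=
    (measurable_normalizedReward L K hp hs t).comp (by fun_prop)
  exact integral_treeLaw hm (bidderState_mem_Icc L K t z.1) _ _

theorem bidderState_fst_le (ω : ℕ → Round) {M : ℝ} (hM0 : 0 ≤ M) (t : ℕ)
    (hM : ∀ i < t, max (ω i).ctx.χ (ω i).ctx.ψ ≤ M) :
    (bidderState p safeBid L K t fun i => ω i).1 ≤ M := by
  induction t with
  | zero => exact hM0
  | succ t ih => exact max_le (ih fun i hi => hM i (by omega)) (hM t (by omega))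

/-- On the concentration event, the realized regret is bounded on every interval of rounds. -/
theorem PaymentAssumption.regret_le (hp : PaymentAssumption p)
    (hs : ∀ c : Context, (∀ d, 0 ≤ reward p c d (safeBid c)) ∧
      ∀ b, (∃ d, reward p c d b < 0) → ∀ d, reward p c d b ≤ reward p c d (safeBid c))
    (hL : 1 ≤ L) {T : ℕ} (hT : 2 ≤ T)
    (hK : 0 < (L : ℝ) → (L : ℝ) ≤ T → √(T / L) ≤ 2 ^ K ∧ 2 ^ K ≤ 2 * √(T / L))
    (ω : ℕ → Round) {N M : ℝ} (hN : 0 ≤ N) {s e : ℕ} (hse : s ≤ e) (he : e < T)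
    (hM : ∀ i ≤ e, max (ω i).ctx.χ (ω i).ctx.ψ ≤ M)
    (hdev : ∀ k < T, deviationSum (normalizedReward p safeBid L K) (expectedReward p safeBid L K)
      (fun t => if t ∈ Finset.Ico k (e + 1) then 1 else 0) T (fun i => ω i) ≤ N)
    {f : unitInterval → unitInterval} (hf : LipschitzWith L f) :
    ∑ t ∈ Finset.Ico s (e + 1), (reward p (ω t).ctx (ω t).d (f (ω t).ctx.v)
        - reward p (ω t).ctx (ω t).d (ω t).b)
      ≤ M * ((84 * Real.exp 8 + 10) * (√(L * T) * Real.log T) + N) := by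
  set st := fun t : ℕ => bidderState p safeBid L K t fun i => ω i with hst
  set u := fun t : ℕ => (st (t + 1)).1 with hudef
  have hu : ∀ t, max (ω t).ctx.χ (ω t).ctx.ψ ≤ u t := fun t => le_max_right _ _
  have hu0 : ∀ t, 0 < u t := fun t =>
    (ω t).ctx.χ_pos.trans_le ((le_max_left _ _).trans (hu t))
  have humono : Monotone u := monotone_nat_of_le_succ fun t => le_max_left _ _
  have hlog := log_two_mul_le hT
  have hM0 : 0 ≤ M := (ω e).ctx.χ_pos.le.trans ((le_max_left _ _).trans (hM e le_rfl))
  have hueM : u e ≤ M := bidderState_fst_le L K ω hM0 (e + 1) fun i hi => hM i (by omega)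
  set A := (84 * Real.exp 8 + 10) * (√((L : ℝ) * T) * Real.log T)
  have hA : 0 ≤ A := mul_nonneg (by positivity) (mul_nonneg (Real.sqrt_nonneg _) (by linarith))
  set y := fun t => (reward p (ω t).ctx (ω t).d (f (ω t).ctx.v)
    - reward p (ω t).ctx (ω t).d (ω t).b) / u t with hy
  -- Normalized regret is needed on every suffix of the interval, because the increasing weights `u
  -- t` are restored by summation by parts.
  have hsuffix : ∀ k, s ≤ k → k ≤ e → ∑ t ∈ Finset.Ico k (e + 1), y t ≤ A + N := by
    intro k _ hke
    have h1 := hp.treeValue_gridPayoff_regret hs hL hT hK ω u hu (fun t => (st t).2)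
      (fun t n j m => bidderState_mem_Icc L K t _ n j m) (fun t => rfl)
      (s := k) (e := e + 1) (by omega) (by omega) hf
    have h2 := hdev k (by omega)
    rw [deviationSum_prefix] at h2
    simp only [ite_mul, one_mul, zero_mul] at h2
    rw [Finset.sum_ite_mem, Finset.inter_eq_right.2 (fun i hi => by
      rw [Finset.mem_Ico] at hi; rw [Finset.mem_range]; omega)] at h2
    refine le_trans (le_of_eq ?_) (add_le_add h1 h2)
    rw [← Finset.sum_add_distrib]
    refine Finset.sum_congr rfl fun t _ => ?_
    have e1 : expectedReward p safeBid L K t (fun j => ω j, (ω t).ctx, (ω t).d)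
      = treeValue (gridPayoff p safeBid K (u t) (ω t).ctx (ω t).d)
          (blockCoord L K (ω t).ctx.v) (st t).2 (2 * K) (2 * 2 ^ K) := rfl
    have e2 : normalizedReward p safeBid L K t ((fun j => ω j, (ω t).ctx, (ω t).d), (ω t).b)
      = reward p (ω t).ctx (ω t).d (ω t).b / u t := rfl
    rw [e1, e2, hy]
    ring
  have hmain := sum_monotone_mul_le humono hse hsuffix (hu0 s).le
  calc _ = ∑ t ∈ Finset.Ico s (e + 1), u t * y t :=
        Finset.sum_congr rfl fun t _ => by rw [hy, mul_div_cancel₀ _ (hu0 t).ne']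
    _ ≤ u e * (A + N) := hmain
    _ ≤ M * (A + N) := mul_le_mul_of_nonneg_right hueM (by linarith)

end Play

theorem mainTheorem2 :
    ∃ C : ℝ, 0 < C ∧
      ∀ p : unitInterval → unitInterval → unitInterval,
        Measurable (Function.uncurry p) → PaymentAssumption p →
      ∀ L : ℝ≥0, 1 ≤ L → ∀ T : ℕ, 2 ≤ T →
      ∃ alg : BiddingAlgorithm, ∀ adv : AdaptiveAdversary, ∀ δ : ℝ, 0 < δ →
        ∃ E : Set (History T), MeasurableSet E ∧
          ENNReal.ofReal (1 - δ) ≤ playLaw alg adv T E ∧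
          ∀ h ∈ E, ∀ τ₁ τ₂ : Fin T, τ₁ ≤ τ₂ →
            ∀ f : unitInterval → unitInterval, LipschitzWith L f →
              ∑ t ∈ Finset.Icc τ₁ τ₂, reward p (h t).ctx (h t).d (f (h t).ctx.v)
                - ∑ t ∈ Finset.Icc τ₁ τ₂, reward p (h t).ctx (h t).d (h t).b
              ≤ C * (maxMultiplier h τ₂ * √((L : ℝ) * T) * Real.log T
                  + maxMultiplier h τ₂ * √((T : ℝ) * Real.log (T / δ))) := by
  refine ⟨84 * Real.exp 8 + 10, by positivity, fun p hpm hp L hL T hT => ?_⟩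
  obtain ⟨safeBid, hsm, hs⟩ := hp.exists_measurable_safe
  obtain ⟨K, hK⟩ := exists_resolution L T
  refine ⟨treeBidder L K hsm hpm, fun adv δ hδ => ?_⟩
  rcases le_or_gt 1 δ with hδ1 | hδ1
  · refine ⟨∅, MeasurableSet.empty, ?_, fun h hh => absurd hh (Set.notMem_empty h)⟩
    rw [ENNReal.ofReal_of_nonpos (by linarith)]
    exact zero_le
  obtain ⟨E, hE, hprob, hdev⟩ := exists_measurableSet_deviationSum_le (treeBidder L K hsm hpm) adv
    (measurable_normalizedReward L K hpm hsm) (normalizedReward_mem_Icc L K)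
    (measurable_expectedReward L K hpm hsm) (integral_normalizedReward L K hpm hsm) hT hδ hδ1
  refine ⟨E, hE, hprob, fun h hh τ₁ τ₂ hτ f hf => ?_⟩
  -- The default only fills in rounds from `T` on, which enter no sum.
  set ω : ℕ → Round := fun n => if hn : n < T then h ⟨n, hn⟩ else h ⟨0, by omega⟩ with hω
  have hωh : ∀ t : Fin T, ω t = h t := fun t => by simp [hω]
  have hprefix : (fun i : Fin T => ω i) = h := funext hωh
  have hmax : ∀ i ≤ (τ₂ : ℕ), max (ω i).ctx.χ (ω i).ctx.ψ ≤ maxMultiplier h τ₂ := by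
    intro i hi
    have hiT : i < T := hi.trans_lt τ₂.2
    have : ω i = h ⟨i, hiT⟩ := hωh ⟨i, hiT⟩
    rw [this]
    exact Finset.le_sup' (fun t => max (h t).ctx.χ (h t).ctx.ψ)
      (Finset.mem_Iic.2 (Fin.le_def.2 hi))
  have hreg := hp.regret_le L K hs hL hT hK ω (N := 2 * √(T * Real.log (T / δ))) (by positivity)
    (s := τ₁) (e := τ₂) hτ τ₂.2 hmax
    (fun k hk => by rw [hprefix]; exact hdev h hh k hk τ₂ τ₂.2) hf
  have hsum : ∀ g : Round → ℝ, ∑ t ∈ Finset.Icc τ₁ τ₂, g (h t)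
      = ∑ t ∈ Finset.Ico (τ₁ : ℕ) (τ₂ + 1), g (ω t) := by
    intro g
    rw [Finset.Ico_add_one_right_eq_Icc, ← Fin.map_valEmbedding_Icc, Finset.sum_map]
    exact Finset.sum_congr rfl fun t _ => congrArg g (hωh t).symm
  rw [← Finset.sum_sub_distrib,
    hsum fun r => reward p r.ctx r.d (f r.ctx.v) - reward p r.ctx r.d r.b]
  refine hreg.trans ?_
  have hM0 : 0 ≤ maxMultiplier h τ₂ :=
    (ω τ₂).ctx.χ_pos.le.trans ((le_max_left _ _).trans (hmax τ₂ le_rfl))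
  have h1 : 0 ≤ maxMultiplier h τ₂ * √(T * Real.log (T / δ)) := by positivity
  have h2 : 0 < Real.exp 8 := Real.exp_pos _
  nlinarith [mul_nonneg h2.le h1]
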